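/- Let $X_1,X_2,\dots$ be iid real random variables with a Lebesgue density $f$. Let $\ell\ge 2$ be an integer and suppose $f\in W^{\ell,1}(\mathbb R)$, i.e. $f$ and its weak derivatives $f^{(1)},\dots,f^{(\ell)}$ lie in $L_1(\mathbb R)$; $f^{(\ell-1)}$ denotes the continuous representative. Let $K:\mathbb R\to\mathbb R$ be a kernel of order $\ell$, that is, $u^jK(u)\in L_1(\mathbb R)$ for $0\le j\le \ell$, $\int K(u)\,du=1$, $\int u^jK(u)\,du=0$ for $1\le j\le \ell-1$, and $k_\ell:=\int u^\ell K(u)\,du\neq 0$; put $\tilde k=\|K\|_1$. Let $F_n$ be the empirical distribution function of $X_1,\dots,X_n$ and, for $h>0$, $$\hat F_n^h(x)=\int_{-\infty}^x \frac1{nh}\sum_{i=1}^n K\!\left(\frac{t-X_i}{h}\right)dt .$$ Let $d$ be either the Kolmogorov distance $d_\infty(F,G)=\sup_x|F(x)-G(x)|$, with $c_d=1$, or, for some integer $k\ge1$, the $k$-th order Kuiper distance $$d_{kuip,k}(F,G)=\sup_{a_1\le b_1\le\dots\le a_k\le b_k}\ \sum_{i=1}^k\bigl|(F(b_i)-F(a_i))-(G(b_i)-G(a_i))\bigr|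 ,$$ with $c_d=2k$. Let $\varepsilon>0$ and $$s(n)=c_d(\tilde k+1+\varepsilon)\left(\frac{\log\log n}{2n}\right)^{1/2}.$$ Then, with probability one, every sequence $(h_n)$ such that $h_n>0$ and $d(F_n,\hat F_n^{h_n})=s(n)$ for all sufficiently large $n$ satisfies $$\liminf_{n\to\infty}\frac{h_n}{\left(\frac{\log\log n}{2n}\right)^{1/(2\ell)}}\ \ge\ \left(\frac{c_d\,\varepsilon\,\ell!}{|k_\ell|\,d(f^{(\ell-1)},0)}\right)^{1/\ell}$$ and $$\limsup_{n\to\infty}\frac{h_n}{\left(\frac{\log\log n}{2n}\right)^{1/(2\ell)}}\ \le\ \left(\frac{c_d\,(2\tilde k+2+\varepsilon)\,\ell!}{|k_\ell|\,d(f^{(\ell-1)},0)}\right)^{1/\ell}.$$ -/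

import Mathlib

open MeasureTheory ProbabilityTheory Filter Topology

noncomputable section

namespace DiscrepancyPrinciple

/-- `K` is a kernel of order `l`: the functions `u ^ j * K u`, `j = 0, …, l`, are Lebesgue
integrable, `K` has integral one, its moments of order `1, …, l - 1` vanish, and its moment of
order `l` does not vanish. -/
structure IsKernelOfOrder (K : ℝ → ℝ) (l : ℕ) : Prop where
  integrable_moment : ∀ j ≤ l, Integrable (fun u : ℝ => u ^ j * K u)
  integral_eq_one : ∫ u, K u = 1
  moment_eq_zero : ∀ j, 1 ≤ j → j < l → ∫ u, u ^ j * K u = 0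
  moment_ne_zero : ∫ u, u ^ l * K u ≠ 0

/-- The `l`-th moment `k_l` of `K`. -/
def kernelMoment (K : ℝ → ℝ) (l : ℕ) : ℝ := ∫ u, u ^ l * K u

/-- The `L¹` norm of `K`. -/
def kernelL1Norm (K : ℝ → ℝ) : ℝ := ∫ u, |K u|

/-- The empirical distribution function of the first `n` terms of the sample `x`. -/
def empiricalDF (n : ℕ) (x : ℕ → ℝ) (t : ℝ) : ℝ :=
  (1 / (n : ℝ)) * ∑ i ∈ Finset.range n, Set.indicator (Set.Ici (x i)) (fun _ => (1 : ℝ)) t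

/-- The kernel density estimator with kernel `K` and bandwidth `h`, built from the first `n`
terms of the sample `x`. -/
def kernelDensityEstimator (K : ℝ → ℝ) (n : ℕ) (h : ℝ) (x : ℕ → ℝ) (t : ℝ) : ℝ :=
  (1 / ((n : ℝ) * h)) * ∑ i ∈ Finset.range n, K ((t - x i) / h)

/-- The kernel estimator of the distribution function: the integral of the kernel density
estimator over `(-∞, t]`. -/
def kernelDFEstimator (K : ℝ → ℝ) (n : ℕ) (h : ℝ) (x : ℕ → ℝ) (t : ℝ) : ℝ :=
  ∫ y in Set.Iic t, kernelDensityEstimator K n h x y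

/-- The Kolmogorov distance (for functions with bounded difference). -/
def kolmogorovDist (F G : ℝ → ℝ) : ℝ := ⨆ x : ℝ, |F x - G x|

/-- The Kuiper distance of order `k` (for functions with bounded difference): the supremum, over
`a₁ ≤ b₁ ≤ a₂ ≤ b₂ ≤ … ≤ a_k ≤ b_k`, of the sums
`∑ i, |(F (b i) - F (a i)) - (G (b i) - G (a i))|`. -/
def kuiperDist (k : ℕ) (F G : ℝ → ℝ) : ℝ :=
  sSup {r : ℝ | ∃ a b : Fin k → ℝ, (∀ i, a i ≤ b i) ∧ (∀ i j, i < j → b i ≤ a j) ∧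
    r = ∑ i, |(F (b i) - F (a i)) - (G (b i) - G (a i))|}

/-- The distances under consideration: the Kolmogorov distance and the Kuiper distances of
order `k ≥ 1`. -/
inductive DistanceKind where
  | kolmogorov : DistanceKind
  | kuiper (k : ℕ+) : DistanceKind

/-- The distance of the given kind between two functions on the line. -/
def DistanceKind.distance : DistanceKind → (ℝ → ℝ) → (ℝ → ℝ) → ℝ
  | .kolmogorov => kolmogorovDist
  | .kuiper k => kuiperDist k

/-- The constant `c_d`: `1` for the Kolmogorov distance, `2 k` for the Kuiper distance of
order `k`. -/
def DistanceKind.const : DistanceKind → ℝ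
  | .kolmogorov => 1
  | .kuiper k => 2 * ((k : ℕ) : ℝ)

/-- `g` is a weak derivative of order `m` of `f` on the real line. -/
structure HasWeakDeriv (m : ℕ) (f g : ℝ → ℝ) : Prop where
  locallyIntegrable : LocallyIntegrable f
  locallyIntegrable_deriv : LocallyIntegrable g
  integral_eq : ∀ η : ℝ → ℝ, ContDiff ℝ ((⊤ : ℕ∞) : WithTop ℕ∞) η → HasCompactSupport η →
    ∫ x, f x * iteratedDeriv m η x = (-1) ^ m * ∫ x, g x * η x

/-- Membership in the Sobolev space `W^{l,1}(ℝ)`: the function and its weak derivatives of order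
at most `l` are Lebesgue integrable. -/
def MemSobolevL1 (l : ℕ) (f : ℝ → ℝ) : Prop :=
  Integrable f ∧ ∀ j ≤ l, ∃ g : ℝ → ℝ, Integrable g ∧ HasWeakDeriv j f g

open Classical in
/-- The continuous representative of the weak derivative of order `m` of `f`. For `f` in
`W^{l,1}(ℝ)` and `m < l` it exists, and it is unique because two continuous functions that agree
almost everywhere are equal. (By convention it is `0` if no continuous representative exists.) -/
def continuousWeakDeriv (m : ℕ) (f : ℝ → ℝ) : ℝ → ℝ :=
  if h : ∃ g : ℝ → ℝ, Continuous g ∧ HasWeakDeriv m f g then h.choose else 0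

/-- The quantity `log log n / (2 n)`. -/
def lilRate (n : ℕ) : ℝ := Real.log (Real.log n) / (2 * n)

/-- The threshold `s(n) = c_d (‖K‖₁ + 1 + ε) (log log n / (2 n))^{1/2}`. -/
def threshold (d : DistanceKind) (K : ℝ → ℝ) (ε : ℝ) (n : ℕ) : ℝ :=
  d.const * (kernelL1Norm K + 1 + ε) * lilRate n ^ (1 / 2 : ℝ)

/-- The positive number `h` is chosen by the discrepancy principle for the distance `d`, from
the first `n` terms of the sample `x`, with threshold value `s`. -/
def IsDiscrepancyBandwidth (d : DistanceKind) (K : ℝ → ℝ) (n : ℕ) (x : ℕ → ℝ) (s h : ℝ) : Prop :=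
  0 < h ∧ d.distance (empiricalDF n x) (kernelDFEstimator K n h x) = s

end DiscrepancyPrinciple

end

/-! Write `F` for the distribution function, `ρ n` for `lilRate n` and `k̃` for the `L¹` norm of
`K`. The estimator is the empirical distribution function smoothed by the rescaled kernel
(`kernelDFEstimator_eq_kernelSmooth`), and smoothing multiplies sup norms by at most `k̃`. Replacing
the empirical function by `F` therefore moves the discrepancy by at most `c_d (1 + k̃)` times the
sup deviation of the empirical function, uniformly in the bandwidth
(`abs_distance_estimator_sub_le`). By the upper half of the Chung–Smirnov law
(`ae_eventually_abs_empiricalDF_sub_cdf_le`) that deviation is at most `(1 + o(1)) (ρ n)^{1/2}`. The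
discrepancy equation thus traps the distance `D n` between `F` and its smooth between `(c_d ε -
o(1)) (ρ n)^{1/2}` and `(c_d (2 k̃ + 2 + ε) + o(1)) (ρ n)^{1/2}`. The exceptional null set comes
from the law alone, so it serves all bandwidth sequences at once.

A Taylor expansion and the vanishing moments give `D n ~ h^l |k_l| d(F^{(l)}, 0) / l!` as `h → 0`,
uniformly on the line (`exists_forall_abs_distance_sub_le`), and `F^{(l)}` is the continuous
representative of `f^{(l-1)}` (`MemSobolevL1.exists_derivatives`). Solving for `h` yields both
bounds.

This needs `h n → 0`, while only `D n → 0` is known. If bandwidths stayed away from zero, a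
subsequence would tend to infinity, making `F` constant, or to a positive limit, making `F`
invariant under smoothing (`tendsto_bandwidth_zero`). Invariance is impossible: in Fourier terms it
forces the transform of `K` to be one near the origin, contradicting the nonzero `l`-th moment
(`not_forall_kernelSmooth_cdf_eq`). The same fact shows that `d(f^{(l-1)}, 0)` is positive.

The law itself is proved by Hoeffding bounds on a fixed grid of quantile levels, Bernstein bounds on
dyadic increments, a maximal inequality over geometric blocks of sample sizes, and Borel–Cantelli.
-/

namespace DiscrepancyPrinciple

/-! ### Exponential maximal inequality via Doob's inequality. -/

section MaximalInequality

variable {Ω : Type*} [mΩ : MeasurableSpace Ω] {P : Measure Ω} [IsProbabilityMeasure P]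

lemma integrable_exp_mul_sum_of_abs_le_one {Y : ℕ → Ω → ℝ} (hm : ∀ i, Measurable (Y i))
    (hb : ∀ i ω, |Y i ω| ≤ 1) (θ : ℝ) (n : ℕ) :
    Integrable (fun ω => Real.exp (θ * ∑ i ∈ Finset.range n, Y i ω)) P := by
  refine Integrable.of_bound (C := Real.exp (|θ| * n)) ?_ ?_
  · have : Measurable (fun ω => Real.exp (θ * ∑ i ∈ Finset.range n, Y i ω)) := by fun_prop
    exact this.aestronglyMeasurable
  · refine ae_of_all _ fun ω => ?_
    rw [Real.norm_eq_abs, Real.abs_exp, Real.exp_le_exp]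
    have h1 : |∑ i ∈ Finset.range n, Y i ω| ≤ n := by
      refine (Finset.abs_sum_le_sum_abs _ _).trans ?_
      refine (Finset.sum_le_sum fun i _ => hb i ω).trans ?_
      simp
    refine (le_abs_self _).trans ?_
    rw [abs_mul]
    gcongr

/-- Exponentials of sums of independent centred bounded variables form a submartingale. -/
lemma submartingale_exp_mul_sum {Y : ℕ → Ω → ℝ} (hm : ∀ i, Measurable (Y i))
    (hind : iIndepFun Y P) (hb : ∀ i ω, |Y i ω| ≤ 1) (h0 : ∀ i, ∫ ω, Y i ω ∂P = 0) (θ : ℝ) :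
    Submartingale (fun n ω => Real.exp (θ * ∑ i ∈ Finset.range (n + 1), Y i ω))
      (Filtration.natural Y fun i => (hm i).stronglyMeasurable) P := by
  have hint1 : ∀ i, Integrable (fun ω => Real.exp (θ * Y i ω)) P := fun i => by
    refine Integrable.of_bound (C := Real.exp |θ|) ?_ ?_
    · exact ((hm i).const_mul θ).exp.aestronglyMeasurable
    · refine ae_of_all _ fun ω => ?_
      rw [Real.norm_eq_abs, Real.abs_exp, Real.exp_le_exp]
      refine (le_abs_self _).trans ?_
      rw [abs_mul]
      exact mul_le_of_le_one_right (abs_nonneg _) (hb i ω)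
  have hYint : ∀ i, Integrable (Y i) P := fun i =>
    Integrable.of_bound (hm i).aestronglyMeasurable 1 (ae_of_all _ fun ω => hb i ω)
  -- The natural filtration at time `n` already contains `Y n`, hence sums over `range (n + 1)`.
  have hadp : StronglyAdapted (Filtration.natural Y fun i => (hm i).stronglyMeasurable)
      (fun n ω => Real.exp (θ * ∑ i ∈ Finset.range (n + 1), Y i ω)) := fun n => by
    have h1 : ∀ i ∈ Finset.range (n + 1),
        StronglyMeasurable[Filtration.natural Y (fun i => (hm i).stronglyMeasurable) n] (Y i) :=
      fun i hi => (Filtration.stronglyAdapted_natural _ i).mono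
        (Filtration.mono _ (Nat.lt_succ_iff.mp (Finset.mem_range.mp hi)))
    have h2 : StronglyMeasurable[Filtration.natural Y (fun i => (hm i).stronglyMeasurable) n]
        (fun ω => ∑ i ∈ Finset.range (n + 1), Y i ω) := by
      exact Finset.stronglyMeasurable_fun_sum _ h1
    exact (Real.continuous_exp.comp (continuous_const.mul continuous_id)).comp_stronglyMeasurable h2
  refine submartingale_nat hadp (fun n => integrable_exp_mul_sum_of_abs_le_one hm hb θ (n + 1)) ?_
  intro n
  have hsplit : (fun ω => Real.exp (θ * ∑ i ∈ Finset.range (n + 1 + 1), Y i ω)) =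
      (fun ω => Real.exp (θ * ∑ i ∈ Finset.range (n + 1), Y i ω)) *
        (fun ω => Real.exp (θ * Y (n + 1) ω)) := by
    ext ω
    rw [Finset.sum_range_succ _ (n + 1), mul_add, Real.exp_add]
    rfl
  have hce : P[fun ω => Real.exp (θ * Y (n + 1) ω) |
      Filtration.natural Y (fun i => (hm i).stronglyMeasurable) n] =ᵐ[P]
      fun _ => ∫ ω, Real.exp (θ * Y (n + 1) ω) ∂P := by
    refine condExp_indep_eq (m₁ := MeasurableSpace.comap (Y (n + 1)) inferInstance)
      (hm (n + 1)).comap_le (Filtration.le _ _) ?_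
      (hind.indep_comap_natural_of_lt (fun i => (hm i).stronglyMeasurable) (Nat.lt_succ_self n))
    exact (Real.continuous_exp.comp
      (continuous_const.mul continuous_id)).comp_stronglyMeasurable
        (comap_measurable (Y (n + 1))).stronglyMeasurable
  have hpull := condExp_mul_of_stronglyMeasurable_left (hadp n)
    (hsplit ▸ integrable_exp_mul_sum_of_abs_le_one (P := P) hm hb θ (n + 1 + 1)) (hint1 (n + 1))
  -- Centring enters only here: integrating `exp y ≥ 1 + y` shows that the conditional factor is at
  -- least one.
  have h1 : 1 ≤ ∫ ω, Real.exp (θ * Y (n + 1) ω) ∂P := by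
    have h2 : ∫ ω, (1 + θ * Y (n + 1) ω) ∂P = 1 := by
      rw [integral_add (integrable_const _) ((hYint _).const_mul _), integral_const_mul, h0]
      simp
    rw [← h2]
    refine integral_mono ((integrable_const _).add ((hYint _).const_mul _)) (hint1 _) fun ω => ?_
    have := Real.add_one_le_exp (θ * Y (n + 1) ω)
    simp only
    linarith
  rw [hsplit]
  filter_upwards [hce, hpull] with ω hω1 hω2
  rw [hω2, Pi.mul_apply, hω1]
  exact le_mul_of_one_le_right (Real.exp_pos _).le h1

/-- An exponential maximal inequality for sums of independent centred bounded variables. -/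
theorem measureReal_exists_sum_ge_le {Y : ℕ → Ω → ℝ} (hm : ∀ i, Measurable (Y i))
    (hind : iIndepFun Y P) (hb : ∀ i ω, |Y i ω| ≤ 1) (h0 : ∀ i, ∫ ω, Y i ω ∂P = 0)
    {θ ψ : ℝ} (hθ : 0 ≤ θ) (hmgf : ∀ i, mgf (Y i) P θ ≤ Real.exp ψ) (N : ℕ) {x : ℝ}
    (hx : 0 < x) :
    P.real {ω | ∃ n ≤ N, x ≤ ∑ i ∈ Finset.range n, Y i ω} ≤ Real.exp (N * ψ - θ * x) := by
  -- The submartingale starts with one summand, so the empty sum, which cannot reach `x > 0`, is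
  -- treated apart.
  rcases N with _ | N
  · have : {ω | ∃ n ≤ 0, x ≤ ∑ i ∈ Finset.range n, Y i ω} = ∅ := by
      ext ω
      simp only [Nat.le_zero_eq, exists_eq_left, Finset.range_zero, Finset.sum_empty,
        Set.mem_ofPred_eq, Set.mem_empty_iff_false, iff_false, not_le]
      exact hx
    rw [this]
    simp only [measureReal_empty]
    positivity
  have hsub := submartingale_exp_mul_sum hm hind hb h0 θ
  have hmax := maximal_ineq hsub (fun n ω => (Real.exp_pos _).le)
    (ε := ⟨Real.exp (θ * x), (Real.exp_pos _).le⟩) N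
  set A := {ω | ((⟨Real.exp (θ * x), (Real.exp_pos _).le⟩ : NNReal) : ℝ) ≤
    (Finset.range (N + 1)).sup' Finset.nonempty_range_add_one
      fun k => Real.exp (θ * ∑ i ∈ Finset.range (k + 1), Y i ω)} with hA
  have hsubset : {ω | ∃ n ≤ N + 1, x ≤ ∑ i ∈ Finset.range n, Y i ω} ⊆ A := by
    rintro ω ⟨n, hn, hxn⟩
    rcases n with _ | n
    · simp only [Finset.range_zero, Finset.sum_empty] at hxn
      exact absurd hx (not_lt.mpr hxn)
    · simp only [hA, Set.mem_ofPred_eq]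
      refine le_trans ?_ (Finset.le_sup' (fun k => Real.exp (θ * ∑ i ∈ Finset.range (k + 1), Y i ω))
        (Finset.mem_range.mpr (by omega : n < N + 1)))
      simp only [Real.exp_le_exp]
      gcongr
  have hint := integrable_exp_mul_sum_of_abs_le_one (P := P) hm hb θ (N + 1)
  have hE : ∫ ω, Real.exp (θ * ∑ i ∈ Finset.range (N + 1), Y i ω) ∂P ≤
      Real.exp ((N + 1 : ℕ) * ψ) := by
    have h1 : ∫ ω, Real.exp (θ * ∑ i ∈ Finset.range (N + 1), Y i ω) ∂P =
        mgf (∑ i ∈ Finset.range (N + 1), Y i) P θ := by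
      simp [mgf, Finset.sum_apply]
    rw [h1, hind.mgf_sum hm]
    refine (Finset.prod_le_prod (fun i _ => mgf_nonneg) fun i _ => hmgf i).trans ?_
    rw [Finset.prod_const, Finset.card_range, ← Real.exp_nat_mul]
  have hbound : Real.exp (θ * x) * P.real A ≤ Real.exp ((N + 1 : ℕ) * ψ) := by
    have h2 := ENNReal.toReal_mono ENNReal.ofReal_ne_top hmax
    rw [ENNReal.toReal_mul, ENNReal.toReal_ofReal
      (integral_nonneg fun ω => (Real.exp_pos _).le)] at h2
    refine le_trans h2 (le_trans ?_ hE)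
    exact setIntegral_le_integral hint (ae_of_all _ fun ω => (Real.exp_pos _).le)
  refine (measureReal_mono hsubset).trans ?_
  rw [Real.exp_sub, le_div_iff₀ (Real.exp_pos _), mul_comm]
  exact hbound

end MaximalInequality

/-! ### Hoeffding and Bernstein bounds for counts of sample points. -/

section CentredCounts

variable {Ω : Type*} [mΩ : MeasurableSpace Ω] {P : Measure Ω} [IsProbabilityMeasure P]

/-- The number of the first `n` terms of the sample `x` in the set `A`, centred at the
expectation for a sample from the distribution `μ`. -/
noncomputable def centredCount (μ : Measure ℝ) (x : ℕ → ℝ) (n : ℕ) (A : Set ℝ) : ℝ :=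
  ∑ i ∈ Finset.range n, (A.indicator (fun _ => (1 : ℝ)) (x i) - μ.real A)

lemma exp_le_one_add_add_sq {y : ℝ} (hy : |y| ≤ 1) : Real.exp y ≤ 1 + y + y ^ 2 := by
  have := Real.abs_exp_sub_one_sub_id_le hy
  have := (abs_le.mp this).2
  linarith

lemma indicator_sub_bound (μ : Measure ℝ) [IsProbabilityMeasure μ] (A : Set ℝ) (y : ℝ) :
    |A.indicator (fun _ => (1 : ℝ)) y - μ.real A| ≤ 1 := by
  have h0 : 0 ≤ μ.real A := measureReal_nonneg
  have h1 : μ.real A ≤ 1 := measureReal_le_one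
  rw [abs_le]
  by_cases h : y ∈ A <;> simp only [h, Set.indicator_of_mem, Set.indicator_of_notMem,
    not_false_eq_true] <;> constructor <;> linarith

lemma integral_indicator_comp {Q : Measure Ω} {X : Ω → ℝ} (hX : Measurable X) {μ : Measure ℝ}
    (hlaw : Q.map X = μ) {A : Set ℝ} (hA : MeasurableSet A) :
    ∫ ω, A.indicator (fun _ => (1 : ℝ)) (X ω) ∂Q = μ.real A := by
  rw [← hlaw, ← integral_map (φ := X) (f := A.indicator fun _ => (1 : ℝ)) hX.aemeasurable
    ((measurable_const.indicator hA).aestronglyMeasurable), integral_indicator_const _ hA]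
  simp

lemma integrable_indicator_comp {X : Ω → ℝ} (hX : Measurable X) {A : Set ℝ}
    (hA : MeasurableSet A) :
    Integrable (fun ω => A.indicator (fun _ => (1 : ℝ)) (X ω)) P := by
  refine Integrable.of_bound
    ((measurable_const.indicator hA).comp hX).aestronglyMeasurable 1 (ae_of_all _ fun ω => ?_)
  by_cases h : X ω ∈ A <;> simp [h]

/-- Hoeffding's lemma on `[0, 1]`: the variance proxy is `1/4`. This sharp constant produces the
factor `1/2` in the iterated logarithm. -/
lemma mgf_indicator_sub_le_hoeffding {X : Ω → ℝ} (hX : Measurable X) {μ : Measure ℝ}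
    (hlaw : P.map X = μ) {A : Set ℝ} (hA : MeasurableSet A) (θ : ℝ) :
    mgf (fun ω => A.indicator (fun _ => (1 : ℝ)) (X ω) - μ.real A) P θ ≤
      Real.exp (θ ^ 2 / 8) := by
  have h := hasSubgaussianMGF_of_mem_Icc (μ := P) (a := 0) (b := 1)
    (X := fun ω => A.indicator (fun _ => (1 : ℝ)) (X ω))
    ((measurable_const.indicator hA).comp hX).aemeasurable
    (ae_of_all _ fun ω => by by_cases h : X ω ∈ A <;> simp [h])
  have h2 := h.mgf_le θ
  rw [integral_indicator_comp hX hlaw hA] at h2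
  refine h2.trans (Real.exp_le_exp.mpr (le_of_eq ?_))
  simp
  ring

/-- The second-order bound `exp y ≤ 1 + y + y²` brings in the variance `q (1 - q) ≤ p`, which makes
the estimate useful for sets of small mass. -/
lemma mgf_indicator_sub_le_bernstein {X : Ω → ℝ} (hX : Measurable X) {μ : Measure ℝ}
    [IsProbabilityMeasure μ] (hlaw : P.map X = μ) {A : Set ℝ} (hA : MeasurableSet A) {θ p : ℝ}
    (hθ : |θ| ≤ 1) (hp : μ.real A ≤ p) :
    mgf (fun ω => A.indicator (fun _ => (1 : ℝ)) (X ω) - μ.real A) P θ ≤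
      Real.exp (p * θ ^ 2) := by
  set q := μ.real A with hq
  have hq0 : 0 ≤ q := measureReal_nonneg
  set I : Ω → ℝ := fun ω => A.indicator (fun _ => (1 : ℝ)) (X ω) with hI
  have hII : ∀ ω, I ω ^ 2 = I ω := fun ω => by by_cases h : X ω ∈ A <;> simp [hI, h]
  have hIint : Integrable I P := integrable_indicator_comp hX hA
  have hIq : ∫ ω, I ω ∂P = q := integral_indicator_comp hX hlaw hA
  -- As `I² = I`, the quadratic bound is affine in `I`; its expectation is `1 + θ² (q - q²)`.
  have hpt : ∀ ω, Real.exp (θ * (I ω - q)) ≤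
      (1 - θ * q + θ ^ 2 * q ^ 2) + (θ + θ ^ 2 - 2 * θ ^ 2 * q) * I ω := fun ω => by
    have h1 : |θ * (I ω - q)| ≤ 1 := by
      rw [abs_mul]
      exact mul_le_one₀ hθ (abs_nonneg _) (indicator_sub_bound μ A (X ω))
    refine (exp_le_one_add_add_sq h1).trans (le_of_eq ?_)
    linear_combination θ ^ 2 * hII ω
  have hint : Integrable (fun ω => (1 - θ * q + θ ^ 2 * q ^ 2) +
      (θ + θ ^ 2 - 2 * θ ^ 2 * q) * I ω) P := (integrable_const _).add (hIint.const_mul _)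
  have h3 : mgf (fun ω => I ω - q) P θ ≤ ∫ ω, ((1 - θ * q + θ ^ 2 * q ^ 2) +
      (θ + θ ^ 2 - 2 * θ ^ 2 * q) * I ω) ∂P :=
    integral_mono_of_nonneg (ae_of_all _ fun ω => (Real.exp_pos _).le) hint (ae_of_all _ hpt)
  refine h3.trans ?_
  rw [integral_add (integrable_const _) (hIint.const_mul _), integral_const_mul, hIq]
  simp only [integral_const, probReal_univ, smul_eq_mul, one_mul]
  have h4 := Real.add_one_le_exp (p * θ ^ 2)
  nlinarith [mul_nonneg (sq_nonneg θ) (sq_nonneg q), mul_le_mul_of_nonneg_right hp (sq_nonneg θ)]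

/-- A maximal inequality for centred counts. -/
theorem measureReal_exists_abs_centredCount_ge_le {X : ℕ → Ω → ℝ} (hX : ∀ i, Measurable (X i))
    (hind : iIndepFun X P) {μ : Measure ℝ} [IsProbabilityMeasure μ]
    (hlaw : ∀ i, P.map (X i) = μ) {A : Set ℝ} (hA : MeasurableSet A) {θ ψ : ℝ} (hθ : 0 ≤ θ)
    (hmgf : ∀ t : ℝ, |t| = θ → ∀ i,
      mgf (fun ω => A.indicator (fun _ => (1 : ℝ)) (X i ω) - μ.real A) P t ≤ Real.exp ψ)
    (N : ℕ) {x : ℝ} (hx : 0 < x) :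
    P.real {ω | ∃ n ≤ N, x ≤ |centredCount μ (fun i => X i ω) n A|} ≤
      2 * Real.exp (N * ψ - θ * x) := by
  set g : ℝ → ℝ := fun y => A.indicator (fun _ => (1 : ℝ)) y - μ.real A with hg
  have hgm : Measurable g := (measurable_const.indicator hA).sub_const _
  have hgb : ∀ y, |g y| ≤ 1 := indicator_sub_bound μ A
  have hg0 : ∀ i, ∫ ω, g (X i ω) ∂P = 0 := fun i => by
    simp only [hg]
    rw [integral_sub (integrable_indicator_comp (hX i) hA) (integrable_const _),
      integral_indicator_comp (hX i) (hlaw i) hA]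
    simp
  have h1 := measureReal_exists_sum_ge_le (P := P) (Y := fun i ω => g (X i ω))
    (fun i => hgm.comp (hX i)) (hind.comp (fun _ => g) fun _ => hgm) (fun i ω => hgb _) hg0 hθ
    (fun i => hmgf θ (abs_of_nonneg hθ) i) N hx
  -- The lower tail is the upper tail of the negated variables.
  have h2 := measureReal_exists_sum_ge_le (P := P) (Y := fun i ω => - g (X i ω)) (θ := θ) (ψ := ψ)
    (fun i => (hgm.comp (hX i)).neg)
    (hind.comp (fun _ y => - g y) fun _ => hgm.neg) (fun i ω => by rw [abs_neg]; exact hgb _)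
    (fun i => by rw [integral_neg, hg0, neg_zero]) hθ
    (fun i => by
      refine le_trans (le_of_eq ?_) (hmgf (-θ) (by rw [abs_neg, abs_of_nonneg hθ]) i)
      simp only [mgf, hg, mul_neg, neg_mul]) N hx
  have hsub : {ω | ∃ n ≤ N, x ≤ |centredCount μ (fun i => X i ω) n A|} ⊆
      {ω | ∃ n ≤ N, x ≤ ∑ i ∈ Finset.range n, g (X i ω)} ∪
      {ω | ∃ n ≤ N, x ≤ ∑ i ∈ Finset.range n, -g (X i ω)} := by
    rintro ω ⟨n, hn, hxn⟩
    rcases le_abs'.mp hxn with h | h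
    · refine Or.inr ⟨n, hn, ?_⟩
      rw [Finset.sum_neg_distrib]
      change x ≤ - centredCount μ (fun i => X i ω) n A
      linarith
    · exact Or.inl ⟨n, hn, h⟩
  refine (measureReal_mono hsub).trans ((measureReal_union_le _ _).trans ?_)
  linarith

/-- The choice `θ = 4x/N` minimises `N θ²/8 - θ x`. -/
theorem measureReal_exists_abs_centredCount_ge_le_hoeffding {X : ℕ → Ω → ℝ}
    (hX : ∀ i, Measurable (X i)) (hind : iIndepFun X P) {μ : Measure ℝ} [IsProbabilityMeasure μ]
    (hlaw : ∀ i, P.map (X i) = μ) {A : Set ℝ} (hA : MeasurableSet A)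
    {N : ℕ} (hN : 0 < N) {x : ℝ} (hx : 0 < x) :
    P.real {ω | ∃ n ≤ N, x ≤ |centredCount μ (fun i => X i ω) n A|} ≤
      2 * Real.exp (-(2 * x ^ 2 / N)) := by
  have hN' : (0 : ℝ) < N := by exact_mod_cast hN
  refine (measureReal_exists_abs_centredCount_ge_le hX hind hlaw hA (θ := 4 * x / N)
    (ψ := (4 * x / N) ^ 2 / 8) (by positivity) (fun t ht i => ?_) N hx).trans (le_of_eq ?_)
  · rw [← ht, sq_abs]
    exact mgf_indicator_sub_le_hoeffding (hX i) (hlaw i) hA t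
  · congr 2
    field_simp
    ring

/-- The choice `θ = x/(2Np)` minimises `N p θ² - θ x`; the restriction `x ≤ 2Np` is exactly `θ ≤ 1`,
where the quadratic bound on the exponential is available. -/
theorem measureReal_exists_abs_centredCount_ge_le_bernstein {X : ℕ → Ω → ℝ}
    (hX : ∀ i, Measurable (X i)) (hind : iIndepFun X P) {μ : Measure ℝ} [IsProbabilityMeasure μ]
    (hlaw : ∀ i, P.map (X i) = μ) {A : Set ℝ} (hA : MeasurableSet A) {p : ℝ} (hp0 : 0 < p)
    (hp : μ.real A ≤ p) {N : ℕ} (hN : 0 < N) {x : ℝ} (hx : 0 < x) (hxN : x ≤ 2 * (N * p)) :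
    P.real {ω | ∃ n ≤ N, x ≤ |centredCount μ (fun i => X i ω) n A|} ≤
      2 * Real.exp (-(x ^ 2 / (4 * (N * p)))) := by
  have hN' : (0 : ℝ) < N := by exact_mod_cast hN
  have hθ0 : 0 ≤ x / (2 * (N * p)) := by positivity
  refine (measureReal_exists_abs_centredCount_ge_le hX hind hlaw hA (θ := x / (2 * (N * p)))
    (ψ := p * (x / (2 * (N * p))) ^ 2) hθ0 (fun t ht i => ?_) N hx).trans (le_of_eq ?_)
  · rw [← ht, sq_abs]
    refine mgf_indicator_sub_le_bernstein (hX i) (hlaw i) hA ?_ hp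
    rw [ht, div_le_one (by positivity)]
    exact hxN
  · congr 2
    field_simp
    ring

end CentredCounts

/-! ### Dyadic chaining over quantile levels. -/

section Chaining

lemma centredCount_mono (μ : Measure ℝ) (x : ℕ → ℝ) (n : ℕ) {A B : Set ℝ} (h : A ⊆ B) :
    centredCount μ x n A ≤ centredCount μ x n B + n * (μ.real B - μ.real A) := by
  have h1 : ∀ i ∈ Finset.range n, A.indicator (fun _ => (1 : ℝ)) (x i) - μ.real A ≤
      (B.indicator (fun _ => (1 : ℝ)) (x i) - μ.real B) + (μ.real B - μ.real A) := fun i _ => by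
    have : A.indicator (fun _ => (1 : ℝ)) (x i) ≤ B.indicator (fun _ => (1 : ℝ)) (x i) :=
      Set.indicator_le_indicator_of_subset h (fun _ => (zero_le_one : (0 : ℝ) ≤ 1)) (x i)
    linarith
  refine (Finset.sum_le_sum h1).trans (le_of_eq ?_)
  rw [Finset.sum_add_distrib]
  simp only [centredCount, Finset.sum_const, Finset.card_range, nsmul_eq_mul]

lemma centredCount_eq_add_diff (μ : Measure ℝ) [IsProbabilityMeasure μ] (x : ℕ → ℝ) (n : ℕ)
    {A B : Set ℝ} (hA : MeasurableSet A) (h : A ⊆ B) :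
    centredCount μ x n B = centredCount μ x n A + centredCount μ x n (B \ A) := by
  unfold centredCount
  rw [← Finset.sum_add_distrib]
  refine Finset.sum_congr rfl fun i _ => ?_
  rw [measureReal_sdiff h hA]
  have h2 : B.indicator (fun _ => (1 : ℝ)) (x i) =
      A.indicator (fun _ => (1 : ℝ)) (x i) + (B \ A).indicator (fun _ => (1 : ℝ)) (x i) := by
    by_cases h3 : x i ∈ A
    · simp [h3, h h3]
    · by_cases h4 : x i ∈ B <;> simp [h3, h4]
  rw [h2]
  ring

/-- The sublevel sets of the distribution function. -/
def cdfSublevel (μ : Measure ℝ) (u : ℝ) : Set ℝ := {x | cdf μ x ≤ u}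

lemma measurableSet_cdfSublevel (μ : Measure ℝ) (u : ℝ) : MeasurableSet (cdfSublevel μ u) :=
  measurableSet_le (monotone_cdf μ).measurable measurable_const

lemma cdfSublevel_mono (μ : Measure ℝ) {u v : ℝ} (h : u ≤ v) :
    cdfSublevel μ u ⊆ cdfSublevel μ v := fun _ hx => le_trans hx h

/-- A nonempty sublevel set at `u < 1` is a closed half-line, and continuity forces the value `u` at
its endpoint. These sets replace the quantile transform, so no generalised inverse is needed. -/
lemma measureReal_cdfSublevel {μ : Measure ℝ} [IsProbabilityMeasure μ]
    (hc : Continuous (cdf μ)) {u : ℝ} (h0 : 0 ≤ u) (h1 : u ≤ 1) :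
    μ.real (cdfSublevel μ u) = u := by
  rcases h1.eq_or_lt with rfl | h1
  · have : cdfSublevel μ 1 = Set.univ := Set.eq_univ_of_forall fun x => cdf_le_one μ x
    rw [this, probReal_univ]
  rcases (cdfSublevel μ u).eq_empty_or_nonempty with he | hne
  · have h2 : u ≤ 0 := ge_of_tendsto (tendsto_cdf_atBot μ) (Eventually.of_forall fun x => by
      by_contra hx
      have : x ∈ cdfSublevel μ u := (not_le.mp hx).le
      simp [he] at this)
    rw [he, measureReal_empty]
    exact le_antisymm h0 h2
  · have hbdd : BddAbove (cdfSublevel μ u) := by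
      obtain ⟨b, hb⟩ := ((tendsto_cdf_atTop μ).eventually (lt_mem_nhds h1)).exists
      refine ⟨b, fun x hx => ?_⟩
      by_contra hxb
      exact absurd (monotone_cdf μ (not_le.mp hxb).le) (not_le.mpr (lt_of_le_of_lt hx hb))
    have hclosed : IsClosed (cdfSublevel μ u) := isClosed_le hc continuous_const
    have hmem := hclosed.csSup_mem hne hbdd
    set q := sSup (cdfSublevel μ u) with hq
    have hIic : cdfSublevel μ u = Set.Iic q := by
      ext x
      exact ⟨fun hx => le_csSup hbdd hx, fun hx => (monotone_cdf μ hx).trans hmem⟩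
    have hge : u ≤ cdf μ q := by
      have h3 : Tendsto (cdf μ) (𝓝[>] q) (𝓝 (cdf μ q)) := (hc.tendsto q).mono_left inf_le_left
      refine ge_of_tendsto h3 ?_
      filter_upwards [self_mem_nhdsWithin] with x hx
      by_contra hxu
      exact absurd (le_csSup hbdd (show x ∈ cdfSublevel μ u from (not_le.mp hxu).le))
        (not_le.mpr hx)
    rw [hIic, ← cdf_eq_real]
    exact le_antisymm hmem hge

/-- Bounds on a coarse dyadic grid and on the dyadic increments give bounds on a fine grid. -/
lemma abs_centredCount_dyadic_le (μ : Measure ℝ) [IsProbabilityMeasure μ] (x : ℕ → ℝ) (n : ℕ)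
    {m₀ : ℕ} {b : ℝ} {c : ℕ → ℝ} (hc : ∀ m, 0 ≤ c m)
    (hb : ∀ j : ℕ, j ≤ 2 ^ m₀ → |centredCount μ x n (cdfSublevel μ (j / 2 ^ m₀))| ≤ b)
    {M : ℕ} (hM : m₀ ≤ M)
    (hinc : ∀ m ∈ Finset.Ioc m₀ M, ∀ j : ℕ, j < 2 ^ m → |centredCount μ x n
      (cdfSublevel μ (((j + 1 : ℕ) : ℝ) / 2 ^ m) \ cdfSublevel μ ((j : ℝ) / 2 ^ m))| ≤ c m) :
    ∀ j : ℕ, j ≤ 2 ^ M → |centredCount μ x n (cdfSublevel μ (j / 2 ^ M))| ≤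
      b + ∑ m ∈ Finset.Ioc m₀ M, c m := by
  induction M, hM using Nat.le_induction with
  | base => simpa using hb
  | succ M hM ih =>
    intro j hj
    have hih := ih fun m hm => hinc m (Finset.Ioc_subset_Ioc_right (Nat.le_succ M) hm)
    rw [Finset.sum_Ioc_succ_top (by omega)]
    have hhalf : ∀ i : ℕ, ((2 * i : ℕ) : ℝ) / 2 ^ (M + 1) = (i : ℝ) / 2 ^ M := fun i => by
      rw [pow_succ]
      push_cast
      field_simp
    -- Even nodes already lie on the coarser grid; odd ones cost a single increment of level `M +
    -- 1`.
    rcases Nat.even_or_odd' j with ⟨i, rfl | rfl⟩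
    · rw [hhalf]
      have := hih i (by rw [pow_succ] at hj; omega)
      linarith [hc (M + 1)]
    · have h1 := hih i (by rw [pow_succ] at hj; omega)
      have h2 := hinc (M + 1) (Finset.mem_Ioc.mpr ⟨by omega, le_rfl⟩) (2 * i)
        (by rw [pow_succ] at hj ⊢; omega)
      rw [centredCount_eq_add_diff μ x n (measurableSet_cdfSublevel μ _)
        (cdfSublevel_mono μ (u := ((2 * i : ℕ) : ℝ) / 2 ^ (M + 1))
          (v := ((2 * i + 1 : ℕ) : ℝ) / 2 ^ (M + 1)) (by gcongr; omega))]
      refine (abs_add_le _ _).trans ?_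
      rw [hhalf] at h2 ⊢
      linarith

/-- Passage from a dyadic grid to all half-lines. -/
lemma abs_centredCount_Iic_le {μ : Measure ℝ} [IsProbabilityMeasure μ]
    (hc : Continuous (cdf μ)) (x : ℕ → ℝ) (n : ℕ) {M : ℕ} {b : ℝ}
    (hb : ∀ j : ℕ, j ≤ 2 ^ M → |centredCount μ x n (cdfSublevel μ (j / 2 ^ M))| ≤ b) (t : ℝ) :
    |centredCount μ x n (Set.Iic t)| ≤ b + n / 2 ^ M := by
  have hpow : (0 : ℝ) < 2 ^ M := by positivity
  set u := cdf μ t with hu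
  have hu0 : 0 ≤ u := cdf_nonneg μ t
  have hu1 : u ≤ 1 := cdf_le_one μ t
  have hμt : μ.real (Set.Iic t) = u := (cdf_eq_real μ t).symm
  -- The level of `t` is bracketed by the neighbouring nodes `j - 1` and `j`, at the price of mass
  -- `1 / 2 ^ M`.
  set j := ⌈2 ^ M * u⌉₊ with hj
  have hjM : j ≤ 2 ^ M := by
    rw [hj, Nat.ceil_le]
    push_cast
    nlinarith
  have hju : u ≤ (j : ℝ) / 2 ^ M := by
    rw [le_div_iff₀ hpow, mul_comm]
    exact Nat.le_ceil _
  have hj1 : (j : ℝ) / 2 ^ M ≤ 1 := by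
    rw [div_le_one hpow]
    exact_mod_cast hjM
  have hjlt : (j : ℝ) < 2 ^ M * u + 1 := Nat.ceil_lt_add_one (by positivity)
  have hjd : (j : ℝ) / 2 ^ M ≤ u + 1 / 2 ^ M := by
    rw [div_le_iff₀ hpow, add_mul, div_mul_cancel₀ _ hpow.ne']
    linarith
  have hn : (0 : ℝ) ≤ n := n.cast_nonneg
  rw [abs_le]
  constructor
  -- For `j = 0` there is no lower node, but then the half-line has mass zero and its centred count
  -- is nonnegative.
  · rcases Nat.eq_zero_or_pos j with h0 | hpos
    · have hu00 : u = 0 := by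
        rw [h0] at hju
        simp only [CharP.cast_eq_zero, zero_div] at hju
        exact le_antisymm hju hu0
      have h1 := centredCount_mono μ x n (Set.empty_subset (Set.Iic t))
      have h2 : centredCount μ x n ∅ = 0 := by simp [centredCount]
      rw [h2, hμt, hu00, measureReal_empty] at h1
      have h3 : 0 ≤ b := (abs_nonneg _).trans (hb 0 (Nat.zero_le _))
      have h4 : 0 ≤ (n : ℝ) / 2 ^ M := by positivity
      linarith
    -- Strictness is what places the lower sublevel set inside `Iic t`, even if the distribution
    -- function is flat near `t`.
    · have hv : (((j - 1 : ℕ) : ℝ)) / 2 ^ M < u := by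
        rw [div_lt_iff₀ hpow, Nat.cast_sub hpos]
        push_cast
        linarith
      have hv0 : 0 ≤ (((j - 1 : ℕ) : ℝ)) / 2 ^ M := by positivity
      have hsub : cdfSublevel μ (((j - 1 : ℕ) : ℝ) / 2 ^ M) ⊆ Set.Iic t := fun y hy => by
        by_contra hyt
        have := monotone_cdf μ (not_le.mp hyt).le
        exact absurd (lt_of_le_of_lt hy hv) (not_lt.mpr this)
      have h1 := centredCount_mono μ x n hsub
      rw [hμt, measureReal_cdfSublevel hc hv0 (hv.le.trans hu1)] at h1
      have h2 := (abs_le.mp (hb (j - 1) (by omega))).1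
      have h3 : u - ((j - 1 : ℕ) : ℝ) / 2 ^ M ≤ 1 / 2 ^ M := by
        rw [Nat.cast_sub hpos]
        push_cast
        rw [sub_div]
        linarith
      have h4 := mul_le_mul_of_nonneg_left h3 hn
      rw [mul_one_div] at h4
      linarith
  · have hsub : Set.Iic t ⊆ cdfSublevel μ ((j : ℝ) / 2 ^ M) := fun y hy =>
      (monotone_cdf μ hy).trans hju
    have h1 := centredCount_mono μ x n hsub
    rw [hμt, measureReal_cdfSublevel hc (hu0.trans hju) hj1] at h1
    have h2 := (abs_le.mp (hb j hjM)).2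
    have h4 := mul_le_mul_of_nonneg_left (sub_le_iff_le_add'.mpr hjd) hn
    rw [mul_one_div] at h4
    linarith

end Chaining

/-! ### Deviation over one block of sample sizes. -/

section Block

variable {Ω : Type*} [mΩ : MeasurableSpace Ω] {P : Measure Ω} [IsProbabilityMeasure P]

/-- A probability bound for the maximal deviation of the empirical distribution function over a
block of sample sizes. -/
theorem measureReal_block_le {X : ℕ → Ω → ℝ} (hX : ∀ i, Measurable (X i))
    (hind : iIndepFun X P) {μ : Measure ℝ} [IsProbabilityMeasure μ]
    (hlaw : ∀ i, P.map (X i) = μ) (hc : Continuous (cdf μ)) {δ : ℝ} (hδ0 : 0 < δ) (hδ1 : δ ≤ 1)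
    {m₀ : ℕ} (hm₀ : ∀ m, m₀ < m → (m : ℝ) + 2 ≤ δ ^ 2 * (9 / 8) ^ m / 16)
    {n₀ N M : ℕ} {L a : ℝ} (hn₀ : 0 < n₀) (hN : (N : ℝ) ≤ (1 + δ) * n₀) (hnN : n₀ ≤ N)
    (hL2 : 2 ≤ L) (hLδ : 1 ≤ δ ^ 2 * L) (hLN : L ≤ Real.log N)
    (ha : a = Real.sqrt (n₀ * L / 2)) (hmM : m₀ ≤ M) (hNM : (N : ℝ) ≤ 4 ^ M)
    (hMN : (4 : ℝ) ^ M ≤ 4 * N) (hM : 2 * (M : ℝ) ≤ (16 / 9) ^ M) :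
    P.real {ω | ∃ n ≤ N, ∃ t, (1 + 7 * δ) * a <
        |centredCount μ (fun i => X i ω) n (Set.Iic t)|} ≤
      (2 * (2 ^ m₀ + 1) + 4) * Real.exp (-((1 + δ) * L)) := by
  have hn₀' : (0 : ℝ) < n₀ := by exact_mod_cast hn₀
  have hNpos : 0 < N := hn₀.trans_le hnN
  have hN' : (0 : ℝ) < N := by exact_mod_cast hNpos
  have hnN' : (n₀ : ℝ) ≤ N := by exact_mod_cast hnN
  have hN2 : (N : ℝ) ≤ 2 * n₀ := hN.trans (by nlinarith)
  have hL0 : 0 < L := by linarith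
  have ha0 : 0 < a := by rw [ha]; positivity
  have ha2 : a ^ 2 = n₀ * L / 2 := by rw [ha]; exact Real.sq_sqrt (by positivity)
  set E₁ : Set Ω := ⋃ j ∈ Finset.range (2 ^ m₀ + 1), {ω | ∃ n ≤ N, (1 + δ) * a ≤
    |centredCount μ (fun i => X i ω) n (cdfSublevel μ ((j : ℝ) / 2 ^ m₀))|} with hE₁
  set E₂ : Set Ω := ⋃ m ∈ Finset.Ioc m₀ M, ⋃ j ∈ Finset.range (2 ^ m),
    {ω | ∃ n ≤ N, δ * (3 / 4) ^ m * a ≤ |centredCount μ (fun i => X i ω) n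
      (cdfSublevel μ (((j + 1 : ℕ) : ℝ) / 2 ^ m) \ cdfSublevel μ ((j : ℝ) / 2 ^ m))|} with hE₂
  -- The `7δ` splits as `δ` for the coarse grid, `4δ` for the geometric sum of increments and `2δ`
  -- for the last discretisation `n / 2 ^ M`.
  have hsub : {ω | ∃ n ≤ N, ∃ t, (1 + 7 * δ) * a <
      |centredCount μ (fun i => X i ω) n (Set.Iic t)|} ⊆ E₁ ∪ E₂ := by
    rintro ω ⟨n, hn, t, ht⟩
    by_contra hω
    simp only [hE₁, hE₂, Set.mem_union, Set.mem_iUnion, not_or, not_exists, Set.mem_ofPred_eq,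
      not_and, not_le] at hω
    obtain ⟨h1, h2⟩ := hω
    have h3 := abs_centredCount_dyadic_le μ (fun i => X i ω) n (m₀ := m₀) (b := (1 + δ) * a)
      (c := fun m => δ * (3 / 4) ^ m * a) (fun m => by positivity)
      (fun j hj => (h1 j (Finset.mem_range.mpr (by omega)) n hn).le) hmM
      (fun m hm j hj => (h2 m hm j (Finset.mem_range.mpr hj) n hn).le)
    have h4 := abs_centredCount_Iic_le hc (fun i => X i ω) n h3 t
    have h5 : ∑ m ∈ Finset.Ioc m₀ M, δ * (3 / 4 : ℝ) ^ m * a ≤ 4 * δ * a := by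
      rw [← Finset.sum_mul, ← Finset.mul_sum]
      have h6 : ∑ m ∈ Finset.Ioc m₀ M, (3 / 4 : ℝ) ^ m ≤ 4 := by
        have := (summable_geometric_of_lt_one (by norm_num : (0 : ℝ) ≤ 3 / 4)
          (by norm_num)).sum_le_tsum (Finset.Ioc m₀ M) (fun i _ => by positivity)
        rw [tsum_geometric_of_lt_one (by norm_num) (by norm_num)] at this
        linarith
      have := mul_le_mul_of_nonneg_right (mul_le_mul_of_nonneg_left h6 hδ0.le) ha0.le
      linarith
    have h7 : (n : ℝ) / 2 ^ M ≤ 2 * δ * a := by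
      have h8 : (n : ℝ) ≤ N := by exact_mod_cast hn
      rw [div_le_iff₀ (by positivity)]
      refine h8.trans ?_
      refine abs_le_of_sq_le_sq' ?_ (by positivity) |>.2
      have h9 : (2 * δ * a * 2 ^ M) ^ 2 = (δ ^ 2 * L) * (2 * n₀) * 4 ^ M := by
        rw [mul_pow, mul_pow, mul_pow, ha2, ← pow_mul, mul_comm M 2, pow_mul]
        norm_num
        ring
      rw [h9, sq]
      have h10 : (N : ℝ) ≤ (δ ^ 2 * L) * (2 * n₀) := by nlinarith
      exact mul_le_mul h10 hNM hN'.le (hN'.le.trans h10)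
    linarith
  have hexp : ∀ {y : ℝ}, (1 + δ) * L ≤ y → Real.exp (-y) ≤ Real.exp (-((1 + δ) * L)) :=
    fun h => Real.exp_le_exp.mpr (neg_le_neg h)
  have hP₁ : P.real E₁ ≤ (2 * (2 ^ m₀ + 1)) * Real.exp (-((1 + δ) * L)) := by
    refine (measureReal_biUnion_finset_le _ _).trans ?_
    have h1 : ∀ j ∈ Finset.range (2 ^ m₀ + 1), P.real {ω | ∃ n ≤ N, (1 + δ) * a ≤
        |centredCount μ (fun i => X i ω) n (cdfSublevel μ ((j : ℝ) / 2 ^ m₀))|} ≤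
        2 * Real.exp (-((1 + δ) * L)) := fun j _ => by
      refine (measureReal_exists_abs_centredCount_ge_le_hoeffding hX hind hlaw
        (measurableSet_cdfSublevel μ _) hNpos (by positivity)).trans ?_
      refine mul_le_mul_of_nonneg_left (hexp ?_) (by norm_num)
      -- One of the two factors `1 + δ` from squaring the threshold is spent on `N ≤ (1 + δ) n₀`;
      -- the other remains in the exponent.
      rw [le_div_iff₀ hN', mul_pow, ha2]
      have := mul_le_mul_of_nonneg_left hN (by positivity : 0 ≤ (1 + δ) * L)
      linarith
    refine (Finset.sum_le_sum h1).trans (le_of_eq ?_)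
    rw [Finset.sum_const, Finset.card_range, nsmul_eq_mul]
    push_cast
    ring
  have hP₂ : P.real E₂ ≤ 4 * Real.exp (-((1 + δ) * L)) := by
    refine (measureReal_biUnion_finset_le _ _).trans ?_
    have h1 : ∀ m ∈ Finset.Ioc m₀ M, P.real (⋃ j ∈ Finset.range (2 ^ m),
        {ω | ∃ n ≤ N, δ * (3 / 4) ^ m * a ≤ |centredCount μ (fun i => X i ω) n
          (cdfSublevel μ (((j + 1 : ℕ) : ℝ) / 2 ^ m) \ cdfSublevel μ ((j : ℝ) / 2 ^ m))|}) ≤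
        2 * Real.exp (-((1 + δ) * L)) * (1 / 2) ^ m := fun m hm => by
      have hm1 := (Finset.mem_Ioc.mp hm).1
      have hm2 := (Finset.mem_Ioc.mp hm).2
      refine (measureReal_biUnion_finset_le _ _).trans ?_
      have h2 : ∀ j ∈ Finset.range (2 ^ m), P.real
          {ω | ∃ n ≤ N, δ * (3 / 4) ^ m * a ≤ |centredCount μ (fun i => X i ω) n
            (cdfSublevel μ (((j + 1 : ℕ) : ℝ) / 2 ^ m) \ cdfSublevel μ ((j : ℝ) / 2 ^ m))|} ≤
          2 * (Real.exp (-((1 + δ) * L)) * (1 / 4) ^ m) := fun j hj => by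
        have hj' : j + 1 ≤ 2 ^ m := Finset.mem_range.mp hj
        have hmass : μ.real (cdfSublevel μ (((j + 1 : ℕ) : ℝ) / 2 ^ m) \
            cdfSublevel μ ((j : ℝ) / 2 ^ m)) ≤ (1 / 2) ^ m := by
          have h3 : ((j + 1 : ℕ) : ℝ) / 2 ^ m ≤ 1 := by
            rw [div_le_one (by positivity)]
            exact_mod_cast hj'
          have h4 : (j : ℝ) / 2 ^ m ≤ ((j + 1 : ℕ) : ℝ) / 2 ^ m := by
            gcongr
            omega
          rw [measureReal_sdiff (cdfSublevel_mono μ h4) (measurableSet_cdfSublevel μ _),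
            measureReal_cdfSublevel hc (by positivity) h3,
            measureReal_cdfSublevel hc (by positivity) (h4.trans h3)]
          push_cast
          rw [one_div, inv_pow]
          field_simp
          linarith
        refine (measureReal_exists_abs_centredCount_ge_le_bernstein hX hind hlaw
          ((measurableSet_cdfSublevel μ _).diff (measurableSet_cdfSublevel μ _))
          (p := (1 / 2) ^ m) (by positivity) hmass hNpos (by positivity) ?_).trans ?_
        · have h5 : (3 / 4 : ℝ) ^ m = (3 / 2) ^ m * (1 / 2) ^ m := by
            rw [← mul_pow]
            norm_num
          rw [h5]
          -- This is Bernstein's range condition. It holds down to the finest level because `L ≤ log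
          -- N ≤ 2M ≤ (16/9)^M` gives `(9/4)^M L ≤ 4^M ≤ 4N`.
          have h6 : (3 / 2 : ℝ) ^ m * a ≤ 2 * N := by
            have h7 : (3 / 2 : ℝ) ^ m ≤ (3 / 2) ^ M :=
              pow_le_pow_right₀ (by norm_num) hm2
            refine (mul_le_mul_of_nonneg_right h7 ha0.le).trans ?_
            refine abs_le_of_sq_le_sq' ?_ (by positivity) |>.2
            have h8 : Real.log N ≤ 2 * M := by
              have h9 := Real.log_le_log hN' hNM
              rw [Real.log_pow] at h9
              have h10 : Real.log 4 ≤ 2 := by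
                have := Real.log_two_lt_d9
                have h11 : (4 : ℝ) = 2 ^ 2 := by norm_num
                rw [h11, Real.log_pow]
                push_cast
                linarith
              nlinarith [(M.cast_nonneg : (0 : ℝ) ≤ M)]
            have h12 : (9 / 4 : ℝ) ^ M * L ≤ 4 * N := by
              refine le_trans ?_ hMN
              have h13 : (4 : ℝ) ^ M = (9 / 4) ^ M * (16 / 9) ^ M := by
                rw [← mul_pow]
                norm_num
              rw [h13]
              exact mul_le_mul_of_nonneg_left (by linarith) (by positivity)
            have h14 : ((3 / 2 : ℝ) ^ M * a) ^ 2 = (9 / 4) ^ M * L * n₀ / 2 := by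
              rw [mul_pow, ha2, ← pow_mul, mul_comm M 2, pow_mul]
              norm_num
              ring
            rw [h14]
            have h15 := mul_le_mul h12 hnN' hn₀'.le (by positivity)
            nlinarith
          have h7 : δ * ((3 / 2 : ℝ) ^ m * a) ≤ 2 * N := by
            refine (mul_le_of_le_one_left (by positivity) hδ1).trans h6
          have h8 := mul_le_mul_of_nonneg_right h7 (by positivity : (0 : ℝ) ≤ (1 / 2) ^ m)
          linarith
        · refine mul_le_mul_of_nonneg_left ?_ (by norm_num)
          have h5 : (1 / 4 : ℝ) ^ m = Real.exp (-(m * Real.log 4)) := by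
            rw [Real.exp_neg, Real.exp_nat_mul, Real.exp_log (by norm_num), one_div, inv_pow]
          rw [h5, ← Real.exp_add, Real.exp_le_exp]
          have h6 : Real.log 4 ≤ L := by
            have := Real.log_two_lt_d9
            have h11 : (4 : ℝ) = 2 ^ 2 := by norm_num
            rw [h11, Real.log_pow]
            push_cast
            linarith
          have h7 : (δ * (3 / 4) ^ m * a) ^ 2 / (4 * (N * (1 / 2) ^ m)) =
              (δ ^ 2 * (9 / 8) ^ m / 16) * L * (2 * n₀ / N) := by
            have h8 : ((3 / 4 : ℝ) ^ m) ^ 2 = (9 / 8) ^ m * (1 / 2) ^ m := by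
              rw [← mul_pow, ← pow_mul, mul_comm m 2, pow_mul]
              norm_num
            rw [mul_pow, mul_pow, ha2, h8]
            field_simp
            ring
          -- Of `(m + 2) L`, the part `m L` pays for `4^{-m}`, which beats the `2^m` intervals, and
          -- `2L` covers `(1 + δ) L`.
          have h8 : ((m : ℝ) + 2) * L ≤
              (δ * (3 / 4) ^ m * a) ^ 2 / (4 * (N * (1 / 2) ^ m)) := by
            rw [h7]
            have h9 : 1 ≤ 2 * n₀ / (N : ℝ) := by
              rw [le_div_iff₀ hN']
              linarith
            refine (mul_le_mul_of_nonneg_right (hm₀ m hm1) hL0.le).trans ?_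
            exact le_mul_of_one_le_right (by positivity) h9
          have h10 := mul_le_mul_of_nonneg_left h6 (m.cast_nonneg : (0 : ℝ) ≤ m)
          have h11 : (1 + δ) * L ≤ 2 * L := by nlinarith
          linarith
      refine (Finset.sum_le_sum h2).trans (le_of_eq ?_)
      rw [Finset.sum_const, Finset.card_range, nsmul_eq_mul]
      have h3 : (1 / 2 : ℝ) ^ m = 2 ^ m * (1 / 4) ^ m := by
        rw [← mul_pow]
        norm_num
      rw [h3]
      push_cast
      ring
    refine (Finset.sum_le_sum h1).trans ?_
    rw [← Finset.mul_sum]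
    have h2 : ∑ m ∈ Finset.Ioc m₀ M, (1 / 2 : ℝ) ^ m ≤ 2 := by
      have := (summable_geometric_of_lt_one (by norm_num : (0 : ℝ) ≤ 1 / 2)
        (by norm_num)).sum_le_tsum (Finset.Ioc m₀ M) (fun i _ => by positivity)
      rw [tsum_geometric_of_lt_one (by norm_num) (by norm_num)] at this
      linarith
    have := mul_le_mul_of_nonneg_left h2
      (by positivity : 0 ≤ 2 * Real.exp (-((1 + δ) * L)))
    linarith
  refine (measureReal_mono hsub).trans ((measureReal_union_le _ _).trans ?_)
  linarith

end Block

/-! ### Borel–Cantelli along geometric blocks and the law of the iterated logarithm. -/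

section IteratedLogarithm

variable {Ω : Type*} [mΩ : MeasurableSpace Ω] {P : Measure Ω} [IsProbabilityMeasure P]

lemma exists_forall_add_two_le_geometric {δ : ℝ} (hδ : 0 < δ) :
    ∃ m₀ : ℕ, ∀ m : ℕ, m₀ < m → (m : ℝ) + 2 ≤ δ ^ 2 * (9 / 8) ^ m / 16 := by
  have h1 := tendsto_pow_const_div_const_pow_of_one_lt 1 (by norm_num : (1 : ℝ) < 9 / 8)
  have h2 := tendsto_pow_const_div_const_pow_of_one_lt 0 (by norm_num : (1 : ℝ) < 9 / 8)
  have h3 := h1.add (h2.const_mul 2)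
  simp only [mul_zero, add_zero] at h3
  obtain ⟨m₀, hm₀⟩ := eventually_atTop.mp
    (h3.eventually (gt_mem_nhds (by positivity : (0 : ℝ) < δ ^ 2 / 16)))
  refine ⟨m₀, fun m hm => ?_⟩
  have h4 := hm₀ m hm.le
  rw [pow_one, pow_zero, mul_one_div, ← add_div, div_lt_iff₀ (by positivity)] at h4
  linarith

lemma eventually_two_mul_le_geometric : ∀ᶠ M : ℕ in atTop, 2 * (M : ℝ) ≤ (16 / 9) ^ M := by
  have h1 := tendsto_pow_const_div_const_pow_of_one_lt 1 (by norm_num : (1 : ℝ) < 16 / 9)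
  filter_upwards [h1.eventually (gt_mem_nhds (by norm_num : (0 : ℝ) < 1 / 2))] with M hM
  rw [pow_one, div_lt_iff₀ (by positivity)] at hM
  linarith

/-- Almost sure bound along one approximation parameter. -/
lemma ae_eventually_abs_centredCount_le {X : ℕ → Ω → ℝ} (hX : ∀ i, Measurable (X i))
    (hind : iIndepFun X P) {μ : Measure ℝ} [IsProbabilityMeasure μ]
    (hlaw : ∀ i, P.map (X i) = μ) (hc : Continuous (cdf μ)) {δ : ℝ} (hδ0 : 0 < δ) (hδ1 : δ ≤ 1) :
    ∀ᵐ ω ∂P, ∀ᶠ n : ℕ in atTop, ∀ t, |centredCount μ (fun i => X i ω) n (Set.Iic t)| ≤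
      (1 + 7 * δ) * Real.sqrt (n * Real.log (Real.log n) / 2) := by
  -- With ratio `√(1 + δ)` rather than `1 + δ`, the spare factor `ρ` absorbs the rounding in `ν`, so
  -- eventually `ν (k + 1) ≤ (1 + δ) ν k`.
  set ρ := Real.sqrt (1 + δ) with hρ
  have hρ2 : ρ * ρ = 1 + δ := Real.mul_self_sqrt (by linarith)
  have hρ1 : 1 < ρ := by
    rw [hρ, Real.lt_sqrt (by norm_num)]
    linarith
  have hρ0 : 0 < ρ := by linarith
  set ν : ℕ → ℕ := fun k => ⌈ρ ^ k⌉₊ with hν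
  have hνge : ∀ k, ρ ^ k ≤ ν k := fun k => Nat.le_ceil _
  have hνpos : ∀ k, 0 < ν k := fun k => Nat.ceil_pos.mpr (by positivity)
  have hνmono : ∀ k, ν k ≤ ν (k + 1) := fun k =>
    Nat.ceil_mono (pow_le_pow_right₀ hρ1.le (Nat.le_succ k))
  have hρtop : Tendsto (fun k : ℕ => ρ ^ k) atTop atTop := tendsto_pow_atTop_atTop_of_one_lt hρ1
  have hνtop : Tendsto (fun k => (ν k : ℝ)) atTop atTop := tendsto_atTop_mono hνge hρtop
  have hlogtop : Tendsto (fun k => Real.log (ν k)) atTop atTop := Real.tendsto_log_atTop.comp hνtop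
  have hLtop : Tendsto (fun k => Real.log (Real.log (ν k))) atTop atTop :=
    Real.tendsto_log_atTop.comp hlogtop
  have hclog : Tendsto (fun k => Nat.clog 4 (ν (k + 1))) atTop atTop := by
    refine tendsto_atTop.mpr fun b => ?_
    have h1 := hνtop.comp (tendsto_add_atTop_nat 1)
    filter_upwards [h1.eventually_ge_atTop ((4 : ℝ) ^ b)] with k hk
    have hk' : 4 ^ b ≤ ν (k + 1) := by
      have h2 : (4 : ℝ) ^ b ≤ ν (k + 1) := hk
      exact_mod_cast h2
    calc b = Nat.clog 4 (4 ^ b) := (Nat.clog_pow 4 b (by norm_num)).symm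
      _ ≤ _ := Nat.clog_mono_right 4 hk'
  obtain ⟨m₀, hm₀⟩ := exists_forall_add_two_le_geometric hδ0
  set B : ℕ → Set Ω := fun k => {ω | ∃ n ≤ ν (k + 1), ∃ t,
    (1 + 7 * δ) * Real.sqrt (ν k * Real.log (Real.log (ν k)) / 2) <
      |centredCount μ (fun i => X i ω) n (Set.Iic t)|} with hB
  set C : ℝ := 2 * (2 ^ m₀ + 1) + 4 with hC
  set u : ℕ → ℝ := fun k => C * (Real.log ρ ^ (-(1 + δ)) * ((k : ℝ) ^ (1 + δ))⁻¹) with hu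
  have hlogρ : 0 < Real.log ρ := Real.log_pos hρ1
  have hu_sum : Summable u :=
    ((Real.summable_nat_rpow_inv.mpr (by linarith)).mul_left _).mul_left _
  have hbound : ∀ᶠ k in atTop, P.real (B k) ≤ u k := by
    have hρtop' : Tendsto (fun k : ℕ => ρ ^ (k + 1) * (ρ - 1)) atTop atTop :=
      (hρtop.comp (tendsto_add_atTop_nat 1)).atTop_mul_const (by linarith)
    filter_upwards [hρtop'.eventually_ge_atTop 1, hLtop.eventually_ge_atTop 2,
      hLtop.eventually_ge_atTop (1 / δ ^ 2), hlogtop.eventually_ge_atTop 1,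
      hclog.eventually_ge_atTop m₀, hclog.eventually_ge_atTop 1,
      hclog.eventually eventually_two_mul_le_geometric, eventually_gt_atTop 0]
      with k h1 h2 h3 h4 h5 h6 h7 h8
    have hk0 : (0 : ℝ) < k := by exact_mod_cast h8
    have hlogpos : 0 < Real.log (ν k) := by linarith
    have hN : (ν (k + 1) : ℝ) ≤ (1 + δ) * ν k := by
      have h9 : (ν (k + 1) : ℝ) < ρ ^ (k + 1) + 1 := Nat.ceil_lt_add_one (by positivity)
      have h10 : ρ ^ (k + 1) + 1 ≤ (1 + δ) * ρ ^ k := by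
        rw [← hρ2]
        rw [pow_succ] at h1 ⊢
        linarith
      exact h9.le.trans (h10.trans (mul_le_mul_of_nonneg_left (hνge k) (by linarith)))
    have hLN : Real.log (Real.log (ν k)) ≤ Real.log (ν (k + 1)) := by
      have h9 := Real.log_le_sub_one_of_pos hlogpos
      have h10 : Real.log (ν k) ≤ Real.log (ν (k + 1)) :=
        Real.log_le_log (by exact_mod_cast hνpos k) (by exact_mod_cast hνmono k)
      linarith
    refine (measureReal_block_le hX hind hlaw hc hδ0 hδ1 hm₀ (hνpos k) hN (hνmono k) h2
      (by rwa [div_le_iff₀' (by positivity)] at h3) hLN rfl h5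
      (by exact_mod_cast Nat.le_pow_clog (by norm_num) (ν (k + 1)))
      ?_ h7).trans ?_
    · have h9 : 4 ^ (Nat.clog 4 (ν (k + 1)) - 1) < ν (k + 1) := by
        refine Nat.pow_pred_clog_lt_self (by norm_num) ?_
        by_contra h10
        have h11 : Nat.clog 4 (ν (k + 1)) = 0 := Nat.clog_of_right_le_one (not_lt.mp h10) 4
        omega
      have h10 : 4 ^ Nat.clog 4 (ν (k + 1)) ≤ 4 * ν (k + 1) := by
        obtain ⟨c, hc'⟩ : ∃ c, Nat.clog 4 (ν (k + 1)) = c + 1 := ⟨_, (Nat.sub_add_cancel h6).symm⟩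
        rw [hc'] at h9 ⊢
        rw [pow_succ]
        simp only [Nat.add_sub_cancel] at h9
        omega
      exact_mod_cast h10
    · refine mul_le_mul_of_nonneg_left ?_ (by positivity)
      rw [← Real.rpow_neg hk0.le, ← Real.mul_rpow hlogρ.le hk0.le]
      -- Since `log (ν k) ≥ k log ρ`, the block probability is of order `k ^ (-(1 + δ))`, which is
      -- summable.
      have h9 : Real.exp (-((1 + δ) * Real.log (Real.log (ν k)))) =
          Real.log (ν k) ^ (-(1 + δ)) := by
        rw [Real.rpow_def_of_pos hlogpos]
        congr 1
        ring
      rw [h9]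
      refine Real.rpow_le_rpow_of_nonpos (by positivity) ?_ (by linarith)
      have h10 := Real.log_le_log (by positivity) (hνge k)
      rw [Real.log_pow] at h10
      linarith
  obtain ⟨k₀, hk₀⟩ := eventually_atTop.mp hbound
  have hsum : (∑' k, P (B (k + k₀))) ≠ ⊤ := by
    have h1 := ((summable_nat_add_iff k₀).mpr hu_sum).tsum_ofReal_ne_top
    refine ne_top_of_le_ne_top h1 (ENNReal.tsum_le_tsum fun k => ?_)
    rw [← ofReal_measureReal]
    exact ENNReal.ofReal_le_ofReal (hk₀ _ (by omega))
  filter_upwards [ae_eventually_notMem hsum] with ω hω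
  obtain ⟨k₁, hk₁⟩ := eventually_atTop.mp hω
  obtain ⟨k₂, hk₂⟩ := eventually_atTop.mp (hLtop.eventually_ge_atTop 0)
  obtain ⟨k₃, hk₃⟩ := eventually_atTop.mp (hlogtop.eventually_ge_atTop 1)
  obtain ⟨n₁, hn₁⟩ := exists_nat_ge (ρ ^ (k₀ + k₁ + k₂ + k₃))
  filter_upwards [eventually_ge_atTop (max n₁ 1)] with n hn t
  have hn1 : (1 : ℝ) ≤ n := by exact_mod_cast (le_max_right _ _).trans hn
  have hnn : ρ ^ (k₀ + k₁ + k₂ + k₃) ≤ n :=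
    hn₁.trans (by exact_mod_cast (le_max_left _ _).trans hn)
  obtain ⟨k, hk, hk'⟩ := exists_nat_pow_near hn1 hρ1
  have hkk : k₀ + k₁ + k₂ + k₃ < k + 1 := by
    by_contra h
    exact absurd (lt_of_le_of_lt hnn hk') (not_lt.mpr (pow_le_pow_right₀ hρ1.le (not_lt.mp h)))
  have hnot : ω ∉ B k := by
    have := hk₁ (k - k₀) (by omega)
    rwa [Nat.sub_add_cancel (by omega)] at this
  have hnk : ν k ≤ n := Nat.ceil_le.mpr hk
  have hnk' : n ≤ ν (k + 1) := by
    exact_mod_cast hk'.le.trans (hνge (k + 1))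
  simp only [hB, Set.mem_ofPred_eq, not_exists, not_and, not_lt] at hnot
  refine (hnot n hnk' t).trans ?_
  have hL0 := hk₂ k (by omega)
  have hl1 := hk₃ k (by omega)
  have hnkR : (ν k : ℝ) ≤ n := by exact_mod_cast hnk
  have hmonolog : Real.log (Real.log (ν k)) ≤ Real.log (Real.log n) :=
    Real.log_le_log (by linarith) (Real.log_le_log (by exact_mod_cast hνpos k) hnkR)
  have h1 : (ν k : ℝ) * Real.log (Real.log (ν k)) ≤ n * Real.log (Real.log n) :=
    mul_le_mul hnkR hmonolog hL0 (by positivity)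
  refine mul_le_mul_of_nonneg_left (Real.sqrt_le_sqrt ?_) (by linarith)
  linarith

lemma empiricalDF_sub_cdf {μ : Measure ℝ} [IsProbabilityMeasure μ] {n : ℕ} (hn : 0 < n)
    (x : ℕ → ℝ) (t : ℝ) :
    empiricalDF n x t - cdf μ t = centredCount μ x n (Set.Iic t) / n := by
  have hn' : (n : ℝ) ≠ 0 := by exact_mod_cast hn.ne'
  have h1 : ∀ i, (Set.Iic t).indicator (fun _ => (1 : ℝ)) (x i) =
      (Set.Ici (x i)).indicator (fun _ => (1 : ℝ)) t := fun i => by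
    by_cases h : x i ≤ t <;> simp [h]
  simp only [empiricalDF, centredCount, h1, ← cdf_eq_real, Finset.sum_sub_distrib,
    Finset.sum_const, Finset.card_range, nsmul_eq_mul]
  field_simp

/-- The upper half of the Chung–Smirnov law of the iterated logarithm. -/
theorem ae_eventually_abs_empiricalDF_sub_cdf_le {X : ℕ → Ω → ℝ} (hX : ∀ i, Measurable (X i))
    (hind : iIndepFun X P) {μ : Measure ℝ} [IsProbabilityMeasure μ]
    (hlaw : ∀ i, P.map (X i) = μ) (hc : Continuous (cdf μ)) :
    ∀ᵐ ω ∂P, ∀ δ : ℝ, 0 < δ → ∀ᶠ n : ℕ in atTop, ∀ t,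
      |empiricalDF n (fun i => X i ω) t - cdf μ t| ≤ (1 + δ) * lilRate n ^ (1 / 2 : ℝ) := by
  -- A countable sequence of parameters gives one null set for all `δ`.
  have h1 : ∀ᵐ ω ∂P, ∀ k : ℕ, ∀ᶠ n : ℕ in atTop, ∀ t,
      |centredCount μ (fun i => X i ω) n (Set.Iic t)| ≤
      (1 + 7 * (1 / ((k : ℝ) + 1))) * Real.sqrt (n * Real.log (Real.log n) / 2) :=
    ae_all_iff.mpr fun k => ae_eventually_abs_centredCount_le hX hind hlaw hc (by positivity)
      (by rw [div_le_one (by positivity)]; linarith [(k.cast_nonneg : (0 : ℝ) ≤ k)])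
  filter_upwards [h1] with ω hω δ hδ
  obtain ⟨k, hk⟩ := exists_nat_one_div_lt (by positivity : 0 < δ / 7)
  filter_upwards [hω k, eventually_gt_atTop 0] with n hn hn0 t
  have hn' : (0 : ℝ) < n := by exact_mod_cast hn0
  rw [empiricalDF_sub_cdf hn0, abs_div, Nat.abs_cast, div_le_iff₀ hn']
  refine (hn t).trans ?_
  have h2 : Real.sqrt (n * Real.log (Real.log n) / 2) = lilRate n ^ (1 / 2 : ℝ) * n := by
    rw [← Real.sqrt_eq_rpow, lilRate]
    have h3 : (n : ℝ) * Real.log (Real.log n) / 2 =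
        Real.log (Real.log n) / (2 * n) * ((n : ℝ) ^ 2) := by
      field_simp
    rw [h3, Real.sqrt_mul' _ (sq_nonneg _), Real.sqrt_sq hn'.le]
  rw [h2, mul_assoc]
  refine mul_le_mul_of_nonneg_right (by linarith) ?_
  rw [← Real.sqrt_eq_rpow]
  positivity

end IteratedLogarithm

/-! ### From weak derivatives to classical derivatives of the distribution function. -/

section WeakDerivatives

/-- A locally integrable function with vanishing weak derivative is almost everywhere constant. -/
theorem ae_eq_const_of_integral_mul_deriv_eq_zero {g : ℝ → ℝ} (hg : LocallyIntegrable g)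
    (h : ∀ η : ℝ → ℝ, ContDiff ℝ ((⊤ : ℕ∞) : WithTop ℕ∞) η → HasCompactSupport η →
      ∫ x, g x * deriv η x = 0) :
    ∃ c : ℝ, g =ᵐ[volume] fun _ => c := by
  set bump : ContDiffBump (0 : ℝ) := default with hbump
  set r : ℝ → ℝ := bump.normed volume with hr
  have hr_smooth : ContDiff ℝ ((⊤ : ℕ∞) : WithTop ℕ∞) r := bump.contDiff_normed
  have hr_supp : HasCompactSupport r := bump.hasCompactSupport_normed
  have hr_int : ∫ x, r x = 1 := bump.integral_normed
  have hint : ∀ φ : ℝ → ℝ, Continuous φ → HasCompactSupport φ →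
      Integrable (fun x => g x * φ x) := fun φ hφ hφs => by
    simpa only [smul_eq_mul, mul_comm] using hg.integrable_smul_left_of_hasCompactSupport hφ hφs
  refine ⟨∫ x, g x * r x, ?_⟩
  refine ae_eq_of_integral_contDiff_smul_eq hg (locallyIntegrable_const _) fun φ hφ hφs => ?_
  set I := ∫ x, φ x with hI
  -- Subtracting the right multiple of a bump makes the integral zero, so the primitive `η` of `ψ`
  -- has compact support and is an admissible test function.
  set ψ : ℝ → ℝ := fun x => φ x - I * r x with hψ
  have hψ_smooth : ContDiff ℝ ((⊤ : ℕ∞) : WithTop ℕ∞) ψ := hφ.sub (contDiff_const.mul hr_smooth)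
  have hψ_supp : HasCompactSupport ψ := hφs.sub (hr_supp.mul_left (f := fun _ => I))
  have hφ_integrable : Integrable φ := hφ.continuous.integrable_of_hasCompactSupport hφs
  have hr_integrable : Integrable r := hr_smooth.continuous.integrable_of_hasCompactSupport hr_supp
  have hψ_int : ∫ x, ψ x = 0 := by
    rw [hψ, integral_sub hφ_integrable (hr_integrable.const_mul _), integral_const_mul, hr_int]
    simp [hI]
  obtain ⟨R, hR⟩ := hψ_supp.isCompact.isBounded.subset_closedBall (0 : ℝ)
  have hψ_zero : ∀ x, R < |x| → ψ x = 0 := fun x hx => by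
    by_contra hne
    have h1 := hR (subset_tsupport ψ hne)
    rw [Metric.mem_closedBall, dist_zero_right, Real.norm_eq_abs] at h1
    linarith
  set η : ℝ → ℝ := fun x => ∫ y in (-(|R| + 1))..x, ψ y with hη
  have hη_deriv : ∀ x, HasDerivAt η (ψ x) x := fun x =>
    intervalIntegral.integral_hasDerivAt_right (hψ_smooth.continuous.intervalIntegrable _ _)
      (hψ_smooth.continuous.stronglyMeasurableAtFilter _ _) hψ_smooth.continuous.continuousAt
  have hη_deriv' : deriv η = ψ := funext fun x => (hη_deriv x).deriv
  have hη_smooth : ContDiff ℝ ((⊤ : ℕ∞) : WithTop ℕ∞) η :=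
    contDiff_infty_iff_deriv.mpr ⟨fun x => (hη_deriv x).differentiableAt, hη_deriv' ▸ hψ_smooth⟩
  have hη_supp : HasCompactSupport η := by
    refine HasCompactSupport.intro (isCompact_Icc (a := -(|R| + 1)) (b := |R| + 1)) fun x hx => ?_
    have hRR := le_abs_self R
    rw [Set.mem_Icc, not_and_or, not_le, not_le] at hx
    rcases hx with hx | hx
    · have : ∀ y ∈ Set.uIcc (-(|R| + 1)) x, ψ y = (fun _ => (0 : ℝ)) y := fun y hy => by
        rw [Set.uIcc_of_ge hx.le] at hy
        refine hψ_zero y ?_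
        have := neg_le_abs y
        linarith [hy.2]
      simp only [hη]
      rw [intervalIntegral.integral_congr this]
      simp
    · simp only [hη]
      rw [intervalIntegral.integral_eq_integral_of_support_subset, hψ_int]
      intro y hy
      have h1 : |y| ≤ R := by
        by_contra hlt
        exact hy (hψ_zero y (not_le.mp hlt))
      have h2 := abs_le.mp h1
      exact ⟨by linarith, by linarith⟩
  have hmain := h η hη_smooth hη_supp
  rw [hη_deriv'] at hmain
  have h1 : ∫ x, g x * ψ x = (∫ x, g x * φ x) - I * ∫ x, g x * r x := by
    rw [← integral_const_mul, ← integral_sub (hint φ hφ.continuous hφs)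
      ((hint r hr_smooth.continuous hr_supp).const_mul _)]
    congr 1
    ext x
    simp only [hψ]
    ring
  simp only [smul_eq_mul]
  rw [integral_mul_const, ← hI]
  simp_rw [mul_comm (φ _)]
  linarith

/-- Integration by parts for the primitive of an integrable function. -/
lemma integral_setIntegral_Iic_mul_deriv {g : ℝ → ℝ} (hg : Integrable g) {η : ℝ → ℝ}
    (hη : ContDiff ℝ 1 η) (hηs : HasCompactSupport η) :
    ∫ x, (∫ y in Set.Iic x, g y) * deriv η x = - ∫ y, g y * η y := by
  have hη' : Integrable (deriv η) :=
    (hη.continuous_deriv le_rfl).integrable_of_hasCompactSupport hηs.deriv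
  have hset : MeasurableSet {p : ℝ × ℝ | p.2 ≤ p.1} := measurableSet_le measurable_snd measurable_fst
  have hint : Integrable ({p : ℝ × ℝ | p.2 ≤ p.1}.indicator
      (fun p : ℝ × ℝ => deriv η p.1 * g p.2)) (volume.prod volume) :=
    (hη'.mul_prod hg).indicator hset
  have h1 : ∀ x, (∫ y in Set.Iic x, g y) * deriv η x =
      ∫ y, {p : ℝ × ℝ | p.2 ≤ p.1}.indicator (fun p : ℝ × ℝ => deriv η p.1 * g p.2) (x, y) :=
    fun x => by
      rw [mul_comm, ← integral_const_mul, ← integral_indicator measurableSet_Iic]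
      rfl
  have h2 : ∀ y, ∫ x, {p : ℝ × ℝ | p.2 ≤ p.1}.indicator
      (fun p : ℝ × ℝ => deriv η p.1 * g p.2) (x, y) = -(g y * η y) := fun y => by
    have h3 : ∀ x, {p : ℝ × ℝ | p.2 ≤ p.1}.indicator
        (fun p : ℝ × ℝ => deriv η p.1 * g p.2) (x, y) =
        (Set.Ici y).indicator (fun x => deriv η x * g y) x := fun x => rfl
    simp_rw [h3]
    rw [integral_indicator measurableSet_Ici, integral_Ici_eq_integral_Ioi, integral_mul_const,
      hηs.integral_Ioi_deriv_eq hη]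
    ring
  simp_rw [h1]
  rw [integral_integral_swap (f := fun x y => {p : ℝ × ℝ | p.2 ≤ p.1}.indicator
    (fun p : ℝ × ℝ => deriv η p.1 * g p.2) (x, y)) hint]
  simp_rw [h2]
  rw [integral_neg]

lemma continuous_setIntegral_Iic {g : ℝ → ℝ} (hg : Integrable g) :
    Continuous fun x => ∫ y in Set.Iic x, g y := by
  have h1 : (fun x => ∫ y in Set.Iic x, g y) =
      fun x => (∫ y in Set.Iic 0, g y) + ∫ y in (0 : ℝ)..x, g y := by
    ext x
    rw [← intervalIntegral.integral_Iic_sub_Iic hg.integrableOn hg.integrableOn]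
    ring
  rw [h1]
  exact continuous_const.add
    (intervalIntegral.continuous_primitive (fun a b => hg.intervalIntegrable) 0)

lemma hasDerivAt_setIntegral_Iic {g : ℝ → ℝ} (hg : Integrable g) (hc : Continuous g) (x : ℝ) :
    HasDerivAt (fun x => ∫ y in Set.Iic x, g y) (g x) x := by
  have h1 : (fun x => ∫ y in Set.Iic x, g y) =
      fun x => (∫ y in Set.Iic 0, g y) + ∫ y in (0 : ℝ)..x, g y := by
    ext x
    rw [← intervalIntegral.integral_Iic_sub_Iic hg.integrableOn hg.integrableOn]
    ring
  rw [h1]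
  exact (intervalIntegral.integral_hasDerivAt_right (hc.intervalIntegrable _ _)
    (hc.stronglyMeasurableAtFilter _ _) hc.continuousAt).const_add _

lemma tendsto_setIntegral_Iic_atTop {g : ℝ → ℝ} (hg : Integrable g) :
    Tendsto (fun x => ∫ y in Set.Iic x, g y) atTop (𝓝 (∫ y, g y)) :=
  (aecover_Iic tendsto_id).integral_tendsto_of_countably_generated hg

/-- An integrable function with an integrable weak derivative is a primitive of it. -/
theorem ae_eq_setIntegral_Iic {g g' : ℝ → ℝ} (hg : Integrable g) (hg' : Integrable g')
    (h : ∀ η : ℝ → ℝ, ContDiff ℝ ((⊤ : ℕ∞) : WithTop ℕ∞) η → HasCompactSupport η →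
      ∫ x, g x * deriv η x = - ∫ x, g' x * η x) :
    g =ᵐ[volume] fun x => ∫ y in Set.Iic x, g' y := by
  set G : ℝ → ℝ := fun x => ∫ y in Set.Iic x, g' y with hG
  have hGc : Continuous G := continuous_setIntegral_Iic hg'
  obtain ⟨c, hc⟩ := ae_eq_const_of_integral_mul_deriv_eq_zero (g := fun x => g x - G x)
    (hg.locallyIntegrable.sub hGc.locallyIntegrable) fun η hη hηs => by
      have hη1 : ContDiff ℝ 1 η := hη.of_le (by exact_mod_cast le_top)
      have hd : Continuous (deriv η) := hη1.continuous_deriv le_rfl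
      have i1 : Integrable (fun x => g x * deriv η x) := by
        simpa only [smul_eq_mul, mul_comm] using
          hg.locallyIntegrable.integrable_smul_left_of_hasCompactSupport hd hηs.deriv
      have i2 : Integrable (fun x => G x * deriv η x) :=
        (hGc.mul hd).integrable_of_hasCompactSupport hηs.deriv.mul_left
      simp_rw [sub_mul]
      rw [integral_sub i1 i2, h η hη hηs, integral_setIntegral_Iic_mul_deriv hg' hη1 hηs]
      ring
  have hgc : g =ᵐ[volume] fun x => c + G x := by
    filter_upwards [hc] with x hx
    linarith
  have hint : Integrable fun x => c + G x := hg.congr hgc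
  have hlim : Tendsto (fun x => c + G x) atBot (𝓝 (c + 0)) :=
    tendsto_const_nhds.add (tendsto_integral_Iic_zero tendsto_id)
  -- An integrable function with a limit at `-∞` must have limit zero.
  have hc0 : c + 0 = 0 := by
    refine IntegrableAtFilter.eq_zero_of_tendsto (μ := volume)
      (hint.integrableAtFilter atBot) ?_ hlim
    intro s hs
    obtain ⟨b, hb⟩ := mem_atBot_sets.mp hs
    rw [← top_le_iff, ← Real.volume_Iic (a := b)]
    exact measure_mono hb
  filter_upwards [hgc] with x hx
  rw [hx]
  linarith

/-- The primitive of a density in `W^{l,1}(ℝ)` is `l` times continuously differentiable, and its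
derivative of order `l` vanishes at infinity and is the continuous weak derivative of order
`l - 1` of the density. -/
theorem MemSobolevL1.exists_derivatives {l : ℕ} (hl : 1 ≤ l) {f : ℝ → ℝ} (hf : MemSobolevL1 l f) :
    ∃ F : ℕ → ℝ → ℝ, (∀ x, F 0 x = ∫ y in Set.Iic x, f y) ∧
      (∀ j < l, ∀ x, HasDerivAt (F j) (F (j + 1) x) x) ∧ Continuous (F l) ∧
      Tendsto (F l) atBot (𝓝 0) ∧ Tendsto (F l) atTop (𝓝 0) ∧
      continuousWeakDeriv (l - 1) f = F l := by
  obtain ⟨hf1, hf2⟩ := hf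
  choose! g hgint hgweak using hf2
  have hstep : ∀ j < l, g j =ᵐ[volume] fun x => ∫ y in Set.Iic x, g (j + 1) y := fun j hj => by
    refine ae_eq_setIntegral_Iic (hgint j hj.le) (hgint (j + 1) hj) fun η hη hηs => ?_
    have hη' : ContDiff ℝ ((⊤ : ℕ∞) : WithTop ℕ∞) (deriv η) := (contDiff_infty_iff_deriv.mp hη).2
    have h1 := (hgweak j hj.le).integral_eq (deriv η) hη' hηs.deriv
    have h2 := (hgweak (j + 1) hj).integral_eq η hη hηs
    rw [iteratedDeriv_succ'] at h2
    rw [h2, pow_succ] at h1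
    have h3 : ((-1 : ℝ) ^ j) * (-1) ^ j = 1 := by
      rw [← mul_pow]
      norm_num
    have h4 := congrArg (fun z => (-1 : ℝ) ^ j * z) h1
    simp only [← mul_assoc, h3] at h4
    linarith
  have hg0 : g 0 =ᵐ[volume] f := by
    refine ae_eq_of_integral_contDiff_smul_eq (hgint 0 (Nat.zero_le _)).locallyIntegrable
      hf1.locallyIntegrable fun η hη hηs => ?_
    have h1 := (hgweak 0 (Nat.zero_le _)).integral_eq η hη hηs
    simp only [iteratedDeriv_zero, pow_zero, one_mul] at h1
    simp only [smul_eq_mul, mul_comm (η _)]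
    exact h1.symm
  -- Since `g j` agrees almost everywhere with the continuous `F (j + 1)`, each `F j` is a primitive
  -- of `F (j + 1)`; only `g l` may lack a continuous version.
  set F : ℕ → ℝ → ℝ := fun j x => ∫ y in Set.Iic x, g j y with hF
  have hFc : ∀ j ≤ l, Continuous (F j) := fun j hj => continuous_setIntegral_Iic (hgint j hj)
  have hstep' : ∀ j < l, g j =ᵐ[volume] F (j + 1) := hstep
  have hlm : l - 1 + 1 = l := Nat.sub_add_cancel hl
  have hgl : g (l - 1) =ᵐ[volume] F l := by
    have := hstep' (l - 1) (by omega)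
    rwa [hlm] at this
  refine ⟨F, fun x => setIntegral_congr_ae measurableSet_Iic (hg0.mono fun y hy _ => hy), ?_,
    hFc l le_rfl, tendsto_integral_Iic_zero tendsto_id, ?_, ?_⟩
  · intro j hj x
    have h1 : F j = fun x => ∫ y in Set.Iic x, F (j + 1) y := by
      ext z
      exact setIntegral_congr_ae measurableSet_Iic ((hstep' j hj).mono fun y hy _ => hy)
    rw [h1]
    exact hasDerivAt_setIntegral_Iic ((hgint j hj.le).congr (hstep' j hj)) (hFc _ hj) x
  · have hlim := tendsto_setIntegral_Iic_atTop (hgint l le_rfl)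
    have h0 : ∫ y, g l y = 0 := by
      refine IntegrableAtFilter.eq_zero_of_tendsto (μ := volume)
        (((hgint (l - 1) (by omega)).congr hgl).integrableAtFilter atTop) ?_ hlim
      intro s hs
      obtain ⟨b, hb⟩ := mem_atTop_sets.mp hs
      rw [← top_le_iff, ← Real.volume_Ici (a := b)]
      exact measure_mono hb
    rwa [h0] at hlim
  · have hweak : HasWeakDeriv (l - 1) f (F l) := by
      refine ⟨hf1.locallyIntegrable, (hFc l le_rfl).locallyIntegrable, fun η hη hηs => ?_⟩
      rw [(hgweak (l - 1) (by omega)).integral_eq η hη hηs]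
      congr 1
      exact integral_congr_ae (hgl.mono fun x hx => by simp only [hx])
    have hex : ∃ g : ℝ → ℝ, Continuous g ∧ HasWeakDeriv (l - 1) f g :=
      ⟨F l, hFc l le_rfl, hweak⟩
    rw [continuousWeakDeriv, dif_pos hex]
    obtain ⟨h1, h2⟩ := hex.choose_spec
    -- The chosen representative is identified by uniqueness: equal pairings with test functions,
    -- then continuity.
    refine (h1.ae_eq_iff_eq volume (hFc l le_rfl)).mp ?_
    refine ae_eq_of_integral_contDiff_smul_eq h1.locallyIntegrable
      (hFc l le_rfl).locallyIntegrable fun η hη hηs => ?_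
    have h3 := (h2.integral_eq η hη hηs).symm.trans (hweak.integral_eq η hη hηs)
    have h4 := mul_left_cancel₀ (pow_ne_zero _ (by norm_num : (-1 : ℝ) ≠ 0)) h3
    simpa only [smul_eq_mul, mul_comm (η _)] using h4

end WeakDerivatives

/-! ### Both distances as suprema of seminorms. -/

section Distances

lemma DistanceKind.const_pos (d : DistanceKind) : 0 < d.const := by
  cases d with
  | kolmogorov => exact one_pos
  | kuiper k =>
    have : 0 < ((k : ℕ) : ℝ) := by exact_mod_cast k.pos
    simp only [DistanceKind.const]
    positivity

lemma DistanceKind.distance_eq_distance_sub (d : DistanceKind) (F G : ℝ → ℝ) :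
    d.distance F G = d.distance (fun x => F x - G x) 0 := by
  cases d with
  | kolmogorov => simp [DistanceKind.distance, kolmogorovDist]
  | kuiper k =>
    have h : ∀ x y, F y - F x - (G y - G x) =
        F y - G y - (F x - G x) - ((0 : ℝ → ℝ) y - (0 : ℝ → ℝ) x) := fun x y => by
      simp only [Pi.zero_apply]
      ring
    simp only [DistanceKind.distance, kuiperDist, h]

/-- The supremum defining a distance to zero, with the properties that characterise it. -/
lemma DistanceKind.exists_index (d : DistanceKind) : ∃ (ι : Type) (c : ι → (ℝ → ℝ) → ℝ),
    Nonempty ι ∧ (∀ φ, d.distance φ 0 = ⨆ i, c i φ) ∧ (∀ i φ, 0 ≤ c i φ) ∧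
    (∀ i φ ψ, c i (fun x => φ x + ψ x) ≤ c i φ + c i ψ) ∧
    (∀ i (a : ℝ) φ, c i (fun x => a * φ x) = |a| * c i φ) ∧
    (∀ i φ B, (∀ x, |φ x| ≤ B) → c i φ ≤ d.const * B) ∧
    ((∃ x : ι → ℝ, Function.Surjective x ∧ ∀ i φ, c i φ = |φ (x i)|) ∨
      ∀ x y, x ≤ y → ∃ i, ∀ φ, |φ y - φ x| ≤ c i φ) := by
  cases d with
  | kolmogorov =>
    refine ⟨ℝ, fun x φ => |φ x|, inferInstance, fun φ => ?_, fun i φ => abs_nonneg _,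
      fun i φ ψ => abs_add_le _ _, fun i a φ => abs_mul _ _, fun i φ B h => ?_,
      Or.inl ⟨id, Function.surjective_id, fun _ _ => rfl⟩⟩
    · simp [DistanceKind.distance, kolmogorovDist]
    · simpa [DistanceKind.const] using h i
  | kuiper k =>
    refine ⟨{p : (Fin k → ℝ) × (Fin k → ℝ) // (∀ i, p.1 i ≤ p.2 i) ∧
        ∀ i j, i < j → p.2 i ≤ p.1 j},
      fun p φ => ∑ i, |φ (p.1.2 i) - φ (p.1.1 i)|, ⟨⟨(0, 0), by simp⟩⟩, fun φ => ?_,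
      fun i φ => Finset.sum_nonneg fun _ _ => abs_nonneg _, fun i φ ψ => ?_, fun i a φ => ?_,
      fun i φ B h => ?_, Or.inr fun x y hxy => ?_⟩
    · simp only [DistanceKind.distance, kuiperDist, iSup]
      congr 1
      ext r
      constructor
      · rintro ⟨a, b, h1, h2, rfl⟩
        exact ⟨⟨(a, b), h1, h2⟩, by simp⟩
      · rintro ⟨⟨⟨a, b⟩, h1, h2⟩, rfl⟩
        exact ⟨a, b, h1, h2, by simp⟩
    · rw [← Finset.sum_add_distrib]
      refine Finset.sum_le_sum fun j _ => ?_
      rw [add_sub_add_comm]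
      exact abs_add_le _ _
    · rw [Finset.mul_sum]
      refine Finset.sum_congr rfl fun j _ => ?_
      rw [← mul_sub, abs_mul]
    · refine (Finset.sum_le_card_nsmul _ _ (2 * B) fun j _ => ?_).trans (le_of_eq ?_)
      · have h1 := abs_sub (φ (i.1.2 j)) (φ (i.1.1 j))
        linarith [h (i.1.2 j), h (i.1.1 j)]
      · simp only [Finset.card_univ, Fintype.card_fin, nsmul_eq_mul, DistanceKind.const]
        ring
    -- A single increment from `x` to `y` is realised at the last index, all earlier intervals being
    -- collapsed at `x`; this respects the ordering constraints.
    · set e : Fin k := ⟨k - 1, Nat.sub_lt k.pos one_pos⟩ with he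
      refine ⟨⟨(fun _ => x, fun i => if i = e then y else x), fun i => ?_, fun i j hij => ?_⟩,
        fun φ => ?_⟩
      · simp only
        split_ifs <;> simp [hxy]
      · have hne : i ≠ e := by
          rintro rfl
          have h1 : (k : ℕ) - 1 < j := hij
          have := j.isLt
          omega
        simp [hne]
      · refine le_trans (le_of_eq ?_) (Finset.single_le_sum
          (f := fun i => |φ (if i = e then y else x) - φ x|) (fun i _ => abs_nonneg _)
          (Finset.mem_univ e))
        simp

lemma DistanceKind.distance_zero_nonneg (d : DistanceKind) (φ : ℝ → ℝ) :
    0 ≤ d.distance φ 0 := by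
  obtain ⟨ι, c, -, h1, h2, -⟩ := d.exists_index
  rw [h1]
  exact Real.iSup_nonneg fun i => h2 i φ

lemma DistanceKind.distance_zero_le (d : DistanceKind) {φ : ℝ → ℝ} {B : ℝ}
    (h : ∀ x, |φ x| ≤ B) : d.distance φ 0 ≤ d.const * B := by
  obtain ⟨ι, c, hne, h1, h2, -, -, h5, -⟩ := d.exists_index
  rw [h1]
  exact ciSup_le fun i => h5 i φ B h

lemma DistanceKind.distance_add_le (d : DistanceKind) {φ ψ : ℝ → ℝ} {B C : ℝ}
    (hφ : ∀ x, |φ x| ≤ B) (hψ : ∀ x, |ψ x| ≤ C) :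
    d.distance (fun x => φ x + ψ x) 0 ≤ d.distance φ 0 + d.distance ψ 0 := by
  obtain ⟨ι, c, hne, h1, h2, h3, -, h5, -⟩ := d.exists_index
  simp only [h1]
  have b1 : BddAbove (Set.range fun i => c i φ) :=
    ⟨d.const * B, by rintro _ ⟨i, rfl⟩; exact h5 i φ B hφ⟩
  have b2 : BddAbove (Set.range fun i => c i ψ) :=
    ⟨d.const * C, by rintro _ ⟨i, rfl⟩; exact h5 i ψ C hψ⟩
  exact ciSup_le fun i => (h3 i φ ψ).trans (add_le_add (le_ciSup b1 i) (le_ciSup b2 i))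

lemma DistanceKind.distance_const_mul (d : DistanceKind) (a : ℝ) (φ : ℝ → ℝ) :
    d.distance (fun x => a * φ x) 0 = |a| * d.distance φ 0 := by
  obtain ⟨ι, c, hne, h1, h2, -, h4, -⟩ := d.exists_index
  simp only [h1, h4]
  rw [Real.mul_iSup_of_nonneg (abs_nonneg a)]

/-- Kuiper distances see increments only, so a value is recovered as the increment from `-∞`, where
`φ` vanishes. -/
lemma DistanceKind.abs_le_distance_zero (d : DistanceKind) {φ : ℝ → ℝ} {B : ℝ}
    (hφ : ∀ x, |φ x| ≤ B) (h0 : Tendsto φ atBot (𝓝 0)) (x : ℝ) : |φ x| ≤ d.distance φ 0 := by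
  obtain ⟨ι, c, hne, h1, h2, -, -, h5, h6⟩ := d.exists_index
  rw [h1]
  have b1 : BddAbove (Set.range fun i => c i φ) :=
    ⟨d.const * B, by rintro _ ⟨i, rfl⟩; exact h5 i φ B hφ⟩
  rcases h6 with ⟨y, hy, hc⟩ | h6
  · obtain ⟨i, rfl⟩ := hy x
    rw [← hc]
    exact le_ciSup b1 i
  · have hlim : Tendsto (fun y => |φ x - φ y|) atBot (𝓝 |φ x - 0|) :=
      (tendsto_const_nhds.sub h0).abs
    rw [sub_zero] at hlim
    refine le_of_tendsto hlim ?_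
    filter_upwards [eventually_le_atBot x] with y hy
    obtain ⟨i, hi⟩ := h6 y x hy
    exact (hi φ).trans (le_ciSup b1 i)

/-- The reverse triangle inequality. The bound `B` only ensures that the real suprema are genuine
and does not enter the estimate. -/
lemma DistanceKind.abs_distance_sub_le (d : DistanceKind) {φ ψ : ℝ → ℝ} {B C : ℝ}
    (hφ : ∀ x, |φ x| ≤ B) (h : ∀ x, |φ x - ψ x| ≤ C) :
    |d.distance φ 0 - d.distance ψ 0| ≤ d.const * C := by
  have hψ : ∀ x, |ψ x| ≤ B + C := fun x => by
    have h1 := abs_sub_abs_le_abs_sub (ψ x) (φ x)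
    rw [abs_sub_comm] at h1
    linarith [hφ x, h x]
  have h' : ∀ x, |ψ x - φ x| ≤ C := fun x => by rw [abs_sub_comm]; exact h x
  have h1 := d.distance_add_le hψ h
  have h2 := d.distance_add_le hφ h'
  simp only [add_sub_cancel] at h1 h2
  have h3 := d.distance_zero_le h
  have h4 := d.distance_zero_le h'
  rw [abs_le]
  constructor <;> linarith

end Distances

/-! ### Kernel smoothing and the stochastic error. -/

section Smoothing

/-- Convolution of a function with the rescaled kernel `h⁻¹ K (· / h)`. -/
noncomputable def kernelSmooth (K : ℝ → ℝ) (h : ℝ) (φ : ℝ → ℝ) (x : ℝ) : ℝ :=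
  ∫ u, K u * φ (x - h * u)

lemma IsKernelOfOrder.integrable {K : ℝ → ℝ} {l : ℕ} (hK : IsKernelOfOrder K l) :
    Integrable K := by simpa using hK.integrable_moment 0 (Nat.zero_le _)

lemma integrable_mul_comp {K : ℝ → ℝ} (hK : Integrable K) {φ : ℝ → ℝ} (hφ : Measurable φ)
    {B : ℝ} (hB : ∀ x, |φ x| ≤ B) (h x : ℝ) : Integrable fun u => K u * φ (x - h * u) :=
  hK.mul_bdd (c := B)
    (hφ.comp (measurable_const.sub (measurable_const.mul measurable_id))).aestronglyMeasurable
    (ae_of_all _ fun _ => hB _)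

lemma abs_kernelSmooth_le {K : ℝ → ℝ} (hK : Integrable K) {φ : ℝ → ℝ}
    {B : ℝ} (hB : ∀ x, |φ x| ≤ B) (h x : ℝ) : |kernelSmooth K h φ x| ≤ kernelL1Norm K * B := by
  rw [kernelL1Norm, ← integral_mul_const, kernelSmooth, ← Real.norm_eq_abs]
  refine norm_integral_le_of_norm_le (hK.abs.mul_const B) (ae_of_all _ fun u => ?_)
  rw [Real.norm_eq_abs, abs_mul]
  exact mul_le_mul_of_nonneg_left (hB _) (abs_nonneg _)

lemma kernelSmooth_sub {K : ℝ → ℝ} (hK : Integrable K) {φ ψ : ℝ → ℝ} (hφ : Measurable φ)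
    (hψ : Measurable ψ) {B C : ℝ} (hB : ∀ x, |φ x| ≤ B) (hC : ∀ x, |ψ x| ≤ C) (h x : ℝ) :
    kernelSmooth K h (fun y => φ y - ψ y) x = kernelSmooth K h φ x - kernelSmooth K h ψ x := by
  simp only [kernelSmooth, mul_sub]
  exact integral_sub (integrable_mul_comp hK hφ hB h x) (integrable_mul_comp hK hψ hC h x)

lemma measurable_empiricalDF (n : ℕ) (x : ℕ → ℝ) : Measurable (empiricalDF n x) :=
  (Finset.measurable_fun_sum _ fun _ _ => measurable_const.indicator measurableSet_Ici).const_mul _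

lemma abs_empiricalDF_le (n : ℕ) (x : ℕ → ℝ) (t : ℝ) : |empiricalDF n x t| ≤ 1 := by
  have h0 : ∀ i, (Set.Ici (x i)).indicator (fun _ => (1 : ℝ)) t ∈ Set.Icc (0 : ℝ) 1 := fun i => by
    by_cases h : t ∈ Set.Ici (x i) <;> simp [h]
  have h1 : 0 ≤ ∑ i ∈ Finset.range n, (Set.Ici (x i)).indicator (fun _ => (1 : ℝ)) t :=
    Finset.sum_nonneg fun i _ => (h0 i).1
  have h2 : ∑ i ∈ Finset.range n, (Set.Ici (x i)).indicator (fun _ => (1 : ℝ)) t ≤ n := by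
    refine (Finset.sum_le_sum fun i _ => (h0 i).2).trans ?_
    simp
  rw [empiricalDF, abs_of_nonneg (by positivity), one_div, inv_mul_eq_div]
  exact div_le_one_of_le₀ h2 n.cast_nonneg

/-- Substituting `y = c + h u` turns the integral of each kernel term over a half-line into the
smooth of the jump at `c`; the rest is linearity. -/
lemma kernelDFEstimator_eq_kernelSmooth {K : ℝ → ℝ} (hK : Integrable K) (n : ℕ) {h : ℝ}
    (hh : 0 < h) (x : ℕ → ℝ) :
    kernelDFEstimator K n h x = kernelSmooth K h (empiricalDF n x) := by
  ext t
  have hterm : ∀ c : ℝ, ∫ y in Set.Iic t, K ((y - c) / h) =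
      h * ∫ u, K u * (Set.Ici c).indicator (fun _ => (1 : ℝ)) (t - h * u) := fun c => by
    rw [← integral_indicator measurableSet_Iic,
      ← integral_add_right_eq_self (μ := (volume : Measure ℝ)) _ c]
    have h1 := Measure.integral_comp_mul_left
      (fun y => (Set.Iic t).indicator (fun y => K ((y - c) / h)) (y + c)) h
    rw [abs_of_pos (inv_pos.mpr hh), smul_eq_mul, eq_inv_mul_iff_mul_eq₀ hh.ne'] at h1
    rw [← h1]
    congr 2
    ext u
    have h2 : (h * u + c - c) / h = u := by
      rw [add_sub_cancel_right, mul_div_cancel_left₀ _ hh.ne']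
    by_cases h3 : h * u + c ≤ t
    · have h4 : c ≤ t - h * u := by linarith
      simp [h3, h4, hh.ne']
    · have h4 : ¬ c ≤ t - h * u := fun h5 => h3 (by linarith)
      simp [h3, h4]
  have hint1 : ∀ c : ℝ, Integrable fun y => K ((y - c) / h) := fun c =>
    (hK.comp_div hh.ne').comp_sub_right c
  have hint2 : ∀ c : ℝ, Integrable fun u =>
      K u * (Set.Ici c).indicator (fun _ => (1 : ℝ)) (t - h * u) := fun c =>
    integrable_mul_comp hK (measurable_const.indicator measurableSet_Ici) (B := 1)
      (fun y => by by_cases h : y ∈ Set.Ici c <;> simp [h]) h t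
  simp only [kernelDFEstimator, kernelDensityEstimator, kernelSmooth, empiricalDF]
  rw [integral_const_mul, integral_finsetSum _ fun i _ => (hint1 (x i)).integrableOn]
  simp_rw [hterm]
  have h5 : ∀ u, K u * (1 / (n : ℝ) * ∑ i ∈ Finset.range n,
      (Set.Ici (x i)).indicator (fun _ => (1 : ℝ)) (t - h * u)) =
      1 / (n : ℝ) * ∑ i ∈ Finset.range n,
        K u * (Set.Ici (x i)).indicator (fun _ => (1 : ℝ)) (t - h * u) := fun u => by
    rw [← Finset.mul_sum]
    ring
  simp_rw [h5]
  rw [integral_const_mul, integral_finsetSum _ fun i _ => hint2 (x i), ← Finset.mul_sum,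
    ← mul_assoc]
  congr 1
  field_simp

/-- Replacing the empirical distribution function by the true one in the discrepancy. -/
lemma abs_distance_estimator_sub_le (d : DistanceKind) {K : ℝ → ℝ} (hK : Integrable K) {n : ℕ}
    {h : ℝ} (hh : 0 < h) (x : ℕ → ℝ) {F : ℝ → ℝ} (hF : Measurable F) {B : ℝ}
    (hB : ∀ t, |F t| ≤ B) {r : ℝ} (hr : ∀ t, |empiricalDF n x t - F t| ≤ r) :
    |d.distance (empiricalDF n x) (kernelDFEstimator K n h x) -
      d.distance (fun t => F t - kernelSmooth K h F t) 0| ≤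
      d.const * ((1 + kernelL1Norm K) * r) := by
  rw [d.distance_eq_distance_sub, kernelDFEstimator_eq_kernelSmooth hK n hh x, abs_sub_comm]
  refine d.abs_distance_sub_le (B := B + kernelL1Norm K * B) (fun t => ?_) fun t => ?_
  · exact (abs_sub _ _).trans (add_le_add (hB t) (abs_kernelSmooth_le hK hB h t))
  · have h1 := kernelSmooth_sub hK (measurable_empiricalDF n x) hF (abs_empiricalDF_le n x) hB h t
    have h2 := abs_kernelSmooth_le hK hr h t
    rw [h1] at h2
    have h3 : F t - kernelSmooth K h F t -
        (empiricalDF n x t - kernelSmooth K h (empiricalDF n x) t) =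
        (kernelSmooth K h (empiricalDF n x) t - kernelSmooth K h F t) -
        (empiricalDF n x t - F t) := by ring
    rw [h3]
    refine (abs_sub _ _).trans ?_
    linarith [hr t]

end Smoothing

/-! ### Uniform asymptotics of the smoothing bias. -/

section Bias

lemma exists_taylor_remainder {l : ℕ} (hl : 1 ≤ l) {F : ℕ → ℝ → ℝ}
    (hF : ∀ j < l, ∀ x, HasDerivAt (F j) (F (j + 1) x) x) (hc : Continuous (F l)) (x y : ℝ) :
    ∃ ξ, |ξ - x| ≤ |y| ∧ F 0 (x + y) = ∑ j ∈ Finset.range l, F j x * y ^ j / (j.factorial : ℝ) +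
      F l ξ * y ^ l / (l.factorial : ℝ) := by
  obtain ⟨n, rfl⟩ : ∃ n, l = n + 1 := ⟨l - 1, by omega⟩
  have hiter : ∀ j ≤ n + 1, iteratedDeriv j (F 0) = F j := by
    intro j
    induction j with
    | zero => intro _; exact iteratedDeriv_zero
    | succ j ih =>
      intro hj
      rw [iteratedDeriv_succ, ih (by omega)]
      exact funext fun z => (hF j (by omega) z).deriv
  have hcd : ContDiff ℝ (n + 1 : ℕ) (F 0) := by
    rw [contDiff_nat_iff_iteratedDeriv]
    refine ⟨fun m hm => ?_, fun m hm => ?_⟩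
    · rw [hiter m hm]
      rcases hm.eq_or_lt with rfl | hm
      · exact hc
      · exact continuous_iff_continuousAt.mpr fun z => (hF m hm z).continuousAt
    · rw [hiter m hm.le]
      exact fun z => (hF m hm z).differentiableAt
  rcases eq_or_ne y 0 with rfl | hy
  · refine ⟨x, by simp, ?_⟩
    rw [Finset.sum_range_succ']
    simp
  have hne : x ≠ x + y := by simpa using hy
  obtain ⟨ξ, hξ, h⟩ := taylor_mean_remainder_lagrange_iteratedDeriv (n := n) hne
    (by exact_mod_cast hcd.contDiffOn)
  refine ⟨ξ, ?_, ?_⟩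
  · have h1 := Set.abs_sub_left_of_mem_uIcc (Set.uIoo_subset_uIcc_self hξ)
    simpa using h1
  · rw [hiter _ le_rfl, sub_eq_iff_eq_add', taylor_within_apply] at h
    rw [h, add_sub_cancel_left]
    congr 1
    refine Finset.sum_congr rfl fun j hj => ?_
    have hj' : j ≤ n + 1 := (Finset.mem_range.mp hj).le
    rw [iteratedDerivWithin_eq_iteratedDeriv (uniqueDiffOn_uIcc hne)
      ((hcd.of_le (by exact_mod_cast hj')).contDiffAt) Set.left_mem_uIcc, hiter j hj', smul_eq_mul]
    field_simp

lemma exists_tail_integral_le {w : ℝ → ℝ} (hw : Integrable w) {η : ℝ} (hη : 0 < η) :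
    ∃ A : ℝ, 0 < A ∧ ∫ u in {u : ℝ | A ≤ |u|}, w u ≤ η := by
  have hmeas : ∀ n : ℕ, MeasurableSet {u : ℝ | (n : ℝ) ≤ |u|} := fun n =>
    measurableSet_le measurable_const measurable_id.abs
  have h1 := tendsto_setIntegral_of_antitone (μ := volume) (f := w)
    (s := fun n : ℕ => {u : ℝ | (n : ℝ) ≤ |u|}) hmeas
    (fun m n hmn u hu => show (m : ℝ) ≤ |u| from le_trans (Nat.cast_le.mpr hmn) hu) ⟨0, hw.integrableOn⟩
  have h2 : ⋂ n : ℕ, {u : ℝ | (n : ℝ) ≤ |u|} = ∅ := by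
    ext u
    simp only [Set.mem_iInter, Set.mem_ofPred_eq, Set.mem_empty_iff_false, iff_false, not_forall,
      not_le]
    exact exists_nat_gt _
  rw [h2, setIntegral_empty] at h1
  obtain ⟨n, hn, hn0⟩ := ((h1.eventually (gt_mem_nhds hη)).and (eventually_gt_atTop 0)).exists
  exact ⟨n, by exact_mod_cast hn0, hn.le⟩

lemma integral_sum_moments {K : ℝ → ℝ} {l : ℕ} (hK : IsKernelOfOrder K l) (hl : 1 ≤ l)
    (c : ℕ → ℝ) : ∫ u, ∑ j ∈ Finset.range l, c j * (u ^ j * K u) = c 0 := by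
  rw [integral_finsetSum _ fun j hj =>
      (hK.integrable_moment j (Finset.mem_range.mp hj).le).const_mul _,
    Finset.sum_eq_single_of_mem 0 (Finset.mem_range.mpr (by omega))]
  · rw [integral_const_mul]
    simp [hK.integral_eq_one]
  · intro j hj hj0
    rw [integral_const_mul, hK.moment_eq_zero j (by omega) (Finset.mem_range.mp hj), mul_zero]

/-- The leading term of the bias of kernel smoothing, uniformly on the line. -/
theorem exists_forall_abs_kernelSmooth_sub_le {K : ℝ → ℝ} {l : ℕ} (hK : IsKernelOfOrder K l)
    (hl : 1 ≤ l) {F : ℕ → ℝ → ℝ} (hF : ∀ j < l, ∀ x, HasDerivAt (F j) (F (j + 1) x) x)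
    (hc : UniformContinuous (F l)) {B₀ B : ℝ} (hB₀ : ∀ x, |F 0 x| ≤ B₀) (hB : ∀ x, |F l x| ≤ B)
    {η : ℝ} (hη : 0 < η) :
    ∃ h₀ : ℝ, 0 < h₀ ∧ ∀ h : ℝ, 0 < h → h < h₀ → ∀ x,
      |kernelSmooth K h (F 0) x - F 0 x -
        (-h) ^ l * kernelMoment K l / (l.factorial : ℝ) * F l x| ≤ η * h ^ l := by
  have hB0 : 0 ≤ B := (abs_nonneg _).trans (hB 0)
  set w : ℝ → ℝ := fun u => |u ^ l * K u| with hw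
  have hwint : Integrable w := (hK.integrable_moment l le_rfl).abs
  set m := ∫ u, w u with hm
  have hm0 : 0 ≤ m := integral_nonneg fun u => abs_nonneg _
  -- The error splits at `|u| = A`: beyond it `F l` is only bounded by `B`, inside it uniform
  -- continuity applies once `h A < δ`. Each part costs `η / 2`; the `+ 1` terms avoid division by
  -- zero.
  obtain ⟨A, hA0, hA⟩ := exists_tail_integral_le hwint
    (by positivity : 0 < η / (2 * (2 * B + 1)))
  obtain ⟨δ, hδ0, hδ⟩ := Metric.uniformContinuous_iff.mp hc (η / (2 * (m + 1))) (by positivity)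
  refine ⟨δ / A, by positivity, fun h hh hhA x => ?_⟩
  have hhA' : h * A < δ := by rwa [lt_div_iff₀ hA0] at hhA
  have hF0m : Measurable (F 0) :=
    (continuous_iff_continuousAt.mpr fun z => (hF 0 (by omega) z).continuousAt).measurable
  set T : ℝ → ℝ := fun u => ∑ j ∈ Finset.range l,
    (F j x * (-h) ^ j / (j.factorial : ℝ)) * (u ^ j * K u) with hT
  have hTterm : ∀ j ∈ Finset.range l, Integrable fun u =>
      (F j x * (-h) ^ j / (j.factorial : ℝ)) * (u ^ j * K u) := fun j hj =>
    (hK.integrable_moment j (Finset.mem_range.mp hj).le).const_mul _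
  have hTint : Integrable T := integrable_finsetSum _ hTterm
  have hTval : ∫ u, T u = F 0 x := by
    rw [hT, integral_sum_moments hK hl]
    simp
  have hLint : Integrable fun u => ((-h) ^ l / (l.factorial : ℝ) * F l x) * (u ^ l * K u) :=
    (hK.integrable_moment l le_rfl).const_mul _
  have hSint := integrable_mul_comp hK.integrable hF0m hB₀ h x
  have heq : kernelSmooth K h (F 0) x - F 0 x -
      (-h) ^ l * kernelMoment K l / (l.factorial : ℝ) * F l x =
      ∫ u, (K u * F 0 (x - h * u) - T u -
        ((-h) ^ l / (l.factorial : ℝ) * F l x) * (u ^ l * K u)) := by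
    have h1 : (fun u => K u * F 0 (x - h * u) - T u) =
        (fun u => K u * F 0 (x - h * u)) - T := rfl
    rw [integral_sub (by rw [h1]; exact hSint.sub hTint) hLint, integral_sub hSint hTint, hTval,
      integral_const_mul, kernelSmooth, kernelMoment]
    ring
  set tail : ℝ → ℝ := {u : ℝ | A ≤ |u|}.indicator w with htail
  have htailm : MeasurableSet {u : ℝ | A ≤ |u|} :=
    measurableSet_le measurable_const measurable_id.abs
  have htailint : Integrable tail := hwint.indicator htailm
  -- The Taylor point `ξ` depends on `u` with no measurability known, so it is eliminated by a
  -- pointwise bound before integrating.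
  have hpt : ∀ u, ‖K u * F 0 (x - h * u) - T u -
      ((-h) ^ l / (l.factorial : ℝ) * F l x) * (u ^ l * K u)‖ ≤
      h ^ l * (η / (2 * (m + 1)) * w u + (2 * B) * tail u) := fun u => by
    obtain ⟨ξ, hξ, hTay⟩ := exists_taylor_remainder hl hF hc.continuous x (-(h * u))
    have h1 : K u * F 0 (x - h * u) - T u -
        ((-h) ^ l / (l.factorial : ℝ) * F l x) * (u ^ l * K u) =
        (-h) ^ l / (l.factorial : ℝ) * ((F l ξ - F l x) * (u ^ l * K u)) := by
      have h2 : K u * ∑ j ∈ Finset.range l, F j x * (-(h * u)) ^ j / (j.factorial : ℝ) = T u := by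
        rw [hT, Finset.mul_sum]
        refine Finset.sum_congr rfl fun j _ => ?_
        rw [← neg_mul, mul_pow]
        ring
      rw [sub_eq_add_neg x, hTay, mul_add, h2, ← neg_mul, mul_pow]
      ring
    rw [h1, Real.norm_eq_abs, abs_mul, abs_mul, abs_div, abs_pow, abs_neg, abs_of_pos hh,
      Nat.abs_cast, div_mul_eq_mul_div]
    have hfac : (1 : ℝ) ≤ (l.factorial : ℝ) := by exact_mod_cast l.factorial_pos
    have hw0 : 0 ≤ w u := abs_nonneg _
    have h3 : |F l ξ - F l x| * w u ≤ η / (2 * (m + 1)) * w u + (2 * B) * tail u := by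
      by_cases hu : A ≤ |u|
      · have h4 : tail u = w u := Set.indicator_of_mem (s := {u : ℝ | A ≤ |u|}) hu w
        have h5 : |F l ξ - F l x| ≤ 2 * B := by
          have := abs_sub (F l ξ) (F l x)
          linarith [hB ξ, hB x]
        rw [h4]
        have h6 : 0 ≤ η / (2 * (m + 1)) * w u := by positivity
        have h7 := mul_le_mul_of_nonneg_right h5 hw0
        linarith
      · have h4 : tail u = 0 := Set.indicator_of_notMem (s := {u : ℝ | A ≤ |u|}) hu w
        rw [h4, mul_zero, add_zero]
        refine mul_le_mul_of_nonneg_right ?_ hw0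
        have h5 : dist ξ x < δ := by
          rw [Real.dist_eq]
          refine hξ.trans_lt (lt_of_le_of_lt ?_ hhA')
          rw [abs_neg, abs_mul, abs_of_pos hh]
          exact mul_le_mul_of_nonneg_left (not_le.mp hu).le hh.le
        exact (hδ h5).le
    rw [div_le_iff₀ (by positivity)]
    refine (mul_le_mul_of_nonneg_left h3 (by positivity)).trans ?_
    refine le_mul_of_one_le_right ?_ hfac
    have : 0 ≤ |F l ξ - F l x| * w u := by positivity
    exact mul_nonneg (by positivity) (this.trans h3)
  rw [heq, ← Real.norm_eq_abs]
  have hint : Integrable fun u => h ^ l * (η / (2 * (m + 1)) * w u + (2 * B) * tail u) :=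
    ((hwint.const_mul _).add (htailint.const_mul _)).const_mul _
  refine (norm_integral_le_of_norm_le hint (ae_of_all _ hpt)).trans ?_
  rw [integral_const_mul, integral_add (hwint.const_mul _) (htailint.const_mul _),
    integral_const_mul, integral_const_mul, ← hm, htail, integral_indicator htailm, mul_comm]
  refine mul_le_mul_of_nonneg_right ?_ (by positivity)
  have h1 : η / (2 * (m + 1)) * m ≤ η / 2 := by
    rw [div_mul_eq_mul_div, div_le_div_iff₀ (by positivity) (by norm_num)]
    nlinarith
  have h2 : 2 * B * ∫ u in {u : ℝ | A ≤ |u|}, w u ≤ η / 2 := by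
    refine (mul_le_mul_of_nonneg_left hA (by positivity)).trans ?_
    rw [mul_div_assoc', div_le_div_iff₀ (by positivity) (by norm_num)]
    nlinarith
  linarith

end Bias

/-! ### No distribution function is invariant under smoothing; bandwidths tend to zero. -/

section Identification

/-- The distribution of `h u` for `u` with (unnormalised) density the positive part of `g`. -/
noncomputable def scaledDensityMeasure (g : ℝ → ℝ) (h : ℝ) : Measure ℝ :=
  (volume.withDensity fun u => ENNReal.ofReal (g u)).map (h * ·)

lemma isFiniteMeasure_scaledDensityMeasure {g : ℝ → ℝ} (hg : Integrable g) (h : ℝ) :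
    IsFiniteMeasure (scaledDensityMeasure g h) := by
  have := isFiniteMeasure_withDensity_ofReal hg.2
  exact Measure.isFiniteMeasure_map _ _

lemma integral_scaledDensityMeasure {E : Type*} [NormedAddCommGroup E] [NormedSpace ℝ E]
    {g : ℝ → ℝ} (hg : Integrable g) (h : ℝ) {φ : ℝ → E} (hφ : StronglyMeasurable φ) :
    ∫ y, φ y ∂scaledDensityMeasure g h = ∫ u, max (g u) 0 • φ (h * u) := by
  rw [scaledDensityMeasure, integral_map (by fun_prop) hφ.aestronglyMeasurable,
    integral_withDensity_eq_integral_toReal_smul₀ hg.aemeasurable.ennreal_ofReal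
      (ae_of_all _ fun _ => ENNReal.ofReal_lt_top)]
  rfl

/-- The signed kernel is split into positive and negative parts, so that convolutions and
characteristic functions of finite measures can be used. -/
lemma integral_scaledDensityMeasure_sub {E : Type*} [NormedAddCommGroup E] [NormedSpace ℝ E]
    {K : ℝ → ℝ} (hK : Integrable K) (h : ℝ) {φ : ℝ → E}
    (hφ : StronglyMeasurable φ) {B : ℝ} (hB : ∀ x, ‖φ x‖ ≤ B) :
    ∫ u, K u • φ (h * u) = ∫ y, φ y ∂scaledDensityMeasure K h -
      ∫ y, φ y ∂scaledDensityMeasure (fun u => -K u) h := by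
  have hm : AEStronglyMeasurable (fun u => φ (h * u)) volume :=
    (hφ.comp_measurable (measurable_const.mul measurable_id)).aestronglyMeasurable
  have hi : ∀ g : ℝ → ℝ, Integrable g → Integrable fun u => max (g u) 0 • φ (h * u) :=
    fun g hg => hg.pos_part.smul_bdd B hm (ae_of_all _ fun u => hB _)
  have hneg : Integrable fun u => -K u := hK.neg
  rw [integral_scaledDensityMeasure hK h hφ, integral_scaledDensityMeasure hneg h hφ,
    ← integral_sub (hi K hK) (hi _ hneg)]
  congr 1
  ext u
  rw [← sub_smul]
  congr 1
  rcases le_total (K u) 0 with h1 | h1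
  · rw [max_eq_right h1, max_eq_left (by linarith)]
    ring
  · rw [max_eq_left h1, max_eq_right (by linarith)]
    ring

lemma measureReal_conv_Iic (μ ν : Measure ℝ) [IsProbabilityMeasure μ] [IsFiniteMeasure ν] (x : ℝ) :
    (ν.conv μ).real (Set.Iic x) = ∫ y, cdf μ (x - y) ∂ν := by
  rw [← integral_indicator_one measurableSet_Iic, integral_conv]
  · congr 1
    ext y
    rw [cdf_eq_real, ← integral_indicator_one measurableSet_Iic]
    congr 1
    ext z
    by_cases h1 : y + z ≤ x
    · have h2 : z ≤ x - y := by linarith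
      simp [h1, h2]
    · have h2 : ¬ z ≤ x - y := fun h3 => h1 (by linarith)
      simp [h1, h2]
  · exact (integrable_const (1 : ℝ)).indicator measurableSet_Iic

/-- A distribution function that is reproduced by kernel smoothing forces the Fourier transform
of the kernel to be one near the origin. -/
lemma exists_integral_mul_exp_eq_one {K : ℝ → ℝ} (hK : Integrable K) {μ : Measure ℝ}
    [IsProbabilityMeasure μ] {h : ℝ} (hh : 0 < h)
    (hfix : ∀ x, kernelSmooth K h (cdf μ) x = cdf μ x) :
    ∃ r : ℝ, 0 < r ∧ ∀ s : ℝ, |s| < r →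
      ∫ u, (K u : ℝ) • Complex.exp (s * u * Complex.I) = 1 := by
  set κ := scaledDensityMeasure K h with hκ
  set κ' := scaledDensityMeasure (fun u => -K u) h with hκ'
  have : IsFiniteMeasure κ := isFiniteMeasure_scaledDensityMeasure hK h
  have : IsFiniteMeasure κ' := isFiniteMeasure_scaledDensityMeasure hK.neg h
  -- Invariance written without subtraction, as an identity between finite measures.
  have hconv : κ.conv μ = κ'.conv μ + μ := by
    refine Measure.ext_of_Iic _ _ fun x => ?_
    have h1 := integral_scaledDensityMeasure_sub hK h (φ := fun y => cdf μ (x - y))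
      (((monotone_cdf μ).measurable.comp (measurable_const.sub measurable_id)).stronglyMeasurable)
      (B := 1) fun y => by
        rw [Real.norm_eq_abs, abs_of_nonneg (cdf_nonneg μ _)]
        exact cdf_le_one μ _
    have h2 := hfix x
    simp only [smul_eq_mul] at h1
    rw [kernelSmooth, h1, ← measureReal_conv_Iic, ← measureReal_conv_Iic, cdf_eq_real] at h2
    rw [Measure.add_apply, ← ofReal_measureReal, ← ofReal_measureReal, ← ofReal_measureReal,
      ← ENNReal.ofReal_add measureReal_nonneg measureReal_nonneg]
    congr 1
    linarith
  have hchar : ∀ t : ℝ, charFun κ t * charFun μ t = charFun κ' t * charFun μ t + charFun μ t :=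
    fun t => by
      rw [← charFun_conv, ← charFun_conv, hconv, charFun_apply_real, charFun_apply_real,
        charFun_apply_real, integral_add_measure] <;>
      exact (integrable_const (1 : ℝ)).mono (by fun_prop) (ae_of_all _ fun x => by
        have h3 : (t : ℂ) * x * Complex.I = ((t * x : ℝ) : ℂ) * Complex.I := by push_cast; ring
        rw [h3, Complex.norm_exp_ofReal_mul_I, norm_one])
  -- Cancelling the characteristic function of `μ` is possible only near the origin, where it is
  -- close to one.
  have hne : ∀ᶠ t in 𝓝 (0 : ℝ), charFun μ t ≠ 0 := by
    have h3 : charFun μ (0 : ℝ) ≠ 0 := by simp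
    exact continuous_charFun.continuousAt.eventually_ne h3
  obtain ⟨r, hr0, hr⟩ := Metric.eventually_nhds_iff.mp hne
  refine ⟨r * h, by positivity, fun s hs => ?_⟩
  have hs' : charFun μ (s / h) ≠ 0 := hr (by
    rw [dist_zero_right, Real.norm_eq_abs, abs_div, abs_of_pos hh]
    rwa [div_lt_iff₀ hh])
  have h4 : charFun κ (s / h) - charFun κ' (s / h) = 1 := by
    have h5 := hchar (s / h)
    have h6 : (charFun κ (s / h) - charFun κ' (s / h)) * charFun μ (s / h) =
        1 * charFun μ (s / h) := by linear_combination h5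
    exact mul_right_cancel₀ hs' h6
  rw [charFun_apply_real, charFun_apply_real] at h4
  have h7 := integral_scaledDensityMeasure_sub hK h
    (φ := fun x : ℝ => Complex.exp (((s / h : ℝ) : ℂ) * x * Complex.I))
    (by
      have : Continuous fun x : ℝ => Complex.exp (((s / h : ℝ) : ℂ) * x * Complex.I) := by fun_prop
      exact this.stronglyMeasurable) (B := 1) fun x => by
        have h3 : ((s / h : ℝ) : ℂ) * x * Complex.I = ((s / h * x : ℝ) : ℂ) * Complex.I := by
          push_cast; ring
        rw [h3, Complex.norm_exp_ofReal_mul_I]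
  rw [← h4, ← h7]
  congr 1
  ext u
  congr 2
  have hhc : (h : ℂ) ≠ 0 := by exact_mod_cast hh.ne'
  push_cast
  field_simp

lemma hasDerivAt_cos_add_mul_pi_div_two (j : ℕ) (x : ℝ) :
    HasDerivAt (fun x => Real.cos (x + j * (Real.pi / 2)))
      (Real.cos (x + ((j + 1 : ℕ) : ℝ) * (Real.pi / 2))) x := by
  have h1 : Real.cos (x + ((j + 1 : ℕ) : ℝ) * (Real.pi / 2)) =
      -Real.sin (x + j * (Real.pi / 2)) * 1 := by
    rw [mul_one, ← Real.cos_add_pi_div_two]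
    congr 1
    push_cast
    ring
  rw [h1]
  exact ((hasDerivAt_id x).add_const _).cos

/-- Kernel smoothing with a kernel of finite order reproduces no distribution function. -/
theorem not_forall_kernelSmooth_cdf_eq {K : ℝ → ℝ} {l : ℕ} (hK : IsKernelOfOrder K l)
    (hl : 1 ≤ l) (μ : Measure ℝ) [IsProbabilityMeasure μ] {h : ℝ} (hh : 0 < h) :
    ¬ ∀ x, kernelSmooth K h (cdf μ) x = cdf μ x := by
  intro hfix
  obtain ⟨r, hr0, hr⟩ := exists_integral_mul_exp_eq_one hK.integrable hh hfix
  -- Testing with the cosine avoids differentiating the Fourier transform: invariance at all small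
  -- scales is compared with the bias expansion.
  have hcos : ∀ s : ℝ, |s| < r → ∀ x, kernelSmooth K s Real.cos x = Real.cos x := fun s hs x => by
    have h1 := hr s hs
    have hint : Integrable fun u : ℝ => (K u : ℝ) • Complex.exp (s * u * Complex.I) :=
      hK.integrable.smul_bdd 1 (by fun_prop) (ae_of_all _ fun u => by
        have h3 : (s : ℂ) * u * Complex.I = ((s * u : ℝ) : ℂ) * Complex.I := by push_cast; ring
        rw [h3, Complex.norm_exp_ofReal_mul_I])
    have hpt : ∀ u : ℝ, Complex.exp (s * u * Complex.I) =
        Complex.cos ((s * u : ℝ)) + Complex.sin ((s * u : ℝ)) * Complex.I := fun u => by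
      rw [← Complex.exp_mul_I]
      push_cast
      rfl
    have hre : ∫ u, K u * Real.cos (s * u) = 1 := by
      have h2 := Complex.reCLM.integral_comp_comm hint
      rw [h1] at h2
      simpa [hpt, ← Complex.ofReal_cos, ← Complex.ofReal_sin, -Complex.ofReal_mul] using h2
    have him : ∫ u, K u * Real.sin (s * u) = 0 := by
      have h2 := Complex.imCLM.integral_comp_comm hint
      rw [h1] at h2
      simpa [hpt, ← Complex.ofReal_cos, ← Complex.ofReal_sin, -Complex.ofReal_mul] using h2
    have i1 : Integrable fun u => K u * Real.cos (s * u) :=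
      hK.integrable.mul_bdd (c := 1) (by fun_prop) (ae_of_all _ fun u => Real.abs_cos_le_one _)
    have i2 : Integrable fun u => K u * Real.sin (s * u) :=
      hK.integrable.mul_bdd (c := 1) (by fun_prop) (ae_of_all _ fun u => Real.abs_sin_le_one _)
    have h3 : ∀ u, K u * Real.cos (x - s * u) =
        Real.cos x * (K u * Real.cos (s * u)) + Real.sin x * (K u * Real.sin (s * u)) := fun u => by
      rw [Real.cos_sub]
      ring
    simp only [kernelSmooth, h3]
    rw [integral_add (i1.const_mul _) (i2.const_mul _), integral_const_mul, integral_const_mul,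
      hre, him]
    ring
  have hc : UniformContinuous fun x : ℝ => Real.cos (x + l * (Real.pi / 2)) :=
    Real.lipschitzWith_cos.uniformContinuous.comp
      (uniformContinuous_id.add uniformContinuous_const)
  have hk : 0 < |kernelMoment K l| := abs_pos.mpr hK.moment_ne_zero
  have hfac : (0 : ℝ) < l.factorial := by exact_mod_cast l.factorial_pos
  obtain ⟨h₀, hh₀, hbias⟩ := exists_forall_abs_kernelSmooth_sub_le hK hl
    (F := fun j x => Real.cos (x + j * (Real.pi / 2)))
    (fun j _ x => hasDerivAt_cos_add_mul_pi_div_two j x) hc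
    (B₀ := 1) (fun x => Real.abs_cos_le_one _) (fun x => Real.abs_cos_le_one _)
    (η := |kernelMoment K l| / l.factorial / 2) (by positivity)
  set s := min h₀ r / 2 with hs
  have hs0 : 0 < s := by positivity
  have hm : 0 < min h₀ r := lt_min hh₀ hr0
  -- At this point the `l`-th derivative of the cosine equals one, so the leading bias is `|k_l| s^l
  -- / l!` in absolute value; half of it was allowed as error.
  have h1 := hbias s hs0 (by linarith [min_le_left h₀ r]) (-(l * (Real.pi / 2)))
  have h2 := hcos s (by rw [abs_of_pos hs0]; linarith [min_le_right h₀ r]) (-(l * (Real.pi / 2)))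
  simp only [Nat.cast_zero, zero_mul, add_zero, neg_add_cancel, Real.cos_zero, mul_one] at h1
  have h3 : (fun x => Real.cos x) = Real.cos := rfl
  rw [h3, h2, sub_self, zero_sub, abs_neg, abs_div, abs_mul, abs_pow, abs_neg, abs_of_pos hs0,
    Nat.abs_cast, mul_div_assoc, mul_comm] at h1
  have h4 := le_of_mul_le_mul_right h1 (by positivity)
  have h5 : 0 < |kernelMoment K l| / l.factorial := by positivity
  linarith

/-- If the kernel smooths of a distribution function converge to it, then the bandwidths tend to
zero. -/
theorem tendsto_bandwidth_zero {K : ℝ → ℝ} {l : ℕ} (hK : IsKernelOfOrder K l) (hl : 1 ≤ l)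
    {μ : Measure ℝ} [IsProbabilityMeasure μ] (hc : Continuous (cdf μ)) {h : ℕ → ℝ}
    (hpos : ∀ᶠ n in atTop, 0 < h n)
    (hlim : ∀ x, Tendsto (fun n => kernelSmooth K (h n) (cdf μ) x) atTop (𝓝 (cdf μ x))) :
    Tendsto h atTop (𝓝 0) := by
  by_contra hnot
  obtain ⟨η, hη0, hη⟩ : ∃ η > 0, ∃ᶠ n in atTop, η ≤ h n := by
    by_contra hcon
    push Not at hcon
    refine hnot (Metric.tendsto_atTop'.mpr ?_)
    intro e he
    obtain ⟨N, hN⟩ := eventually_atTop.mp ((hcon e he).and hpos)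
    refine ⟨N, fun n hn => ?_⟩
    obtain ⟨h1, h2⟩ := hN n hn.le
    rw [dist_zero_right, Real.norm_eq_abs, abs_of_pos h2]
    exact h1
  obtain ⟨p, hp, hpη⟩ := extraction_of_frequently_atTop hη
  -- Passing to inverses compactifies the bandwidths: the limit zero stands for bandwidths tending
  -- to infinity.
  have hmem : ∀ n, (h (p n))⁻¹ ∈ Set.Icc (0 : ℝ) η⁻¹ := fun n =>
    ⟨inv_nonneg.mpr (hη0.le.trans (hpη n)), inv_anti₀ hη0 (hpη n)⟩
  obtain ⟨s, hs, q, hq, hsq⟩ := isCompact_Icc.tendsto_subseq hmem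
  set b : ℕ → ℝ := fun n => h (p (q n)) with hb
  have hbη : ∀ n, η ≤ b n := fun n => hpη (q n)
  have hblim : ∀ x, Tendsto (fun n => kernelSmooth K (b n) (cdf μ) x) atTop (𝓝 (cdf μ x)) :=
    fun x => (hlim x).comp (hp.tendsto_atTop.comp hq.tendsto_atTop)
  have habs : ∀ y, |cdf μ y| ≤ 1 := fun y => by
    rw [abs_of_nonneg (cdf_nonneg μ y)]
    exact cdf_le_one μ y
  have hdct : ∀ x (L : ℝ → ℝ), (∀ᵐ u, Tendsto (fun n => cdf μ (x - b n * u)) atTop (𝓝 (L u))) →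
      Tendsto (fun n => kernelSmooth K (b n) (cdf μ) x) atTop (𝓝 (∫ u, K u * L u)) := by
    intro x L hL
    refine tendsto_integral_of_dominated_convergence (fun u => |K u|)
      (fun n => (integrable_mul_comp hK.integrable hc.measurable habs (b n) x).aestronglyMeasurable)
      hK.integrable.abs (fun n => ae_of_all _ fun u => ?_) ?_
    · rw [Real.norm_eq_abs, abs_mul]
      exact mul_le_of_le_one_right (abs_nonneg _) (habs _)
    · filter_upwards [hL] with u hu
      exact hu.const_mul _
  rcases hs.1.eq_or_lt with h0 | h0
  · have hbtop : Tendsto b atTop atTop := by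
      have h1 : Tendsto (fun n => (b n)⁻¹) atTop (𝓝[>] 0) := by
        refine tendsto_nhdsWithin_iff.mpr ⟨by rw [h0]; exact hsq, Eventually.of_forall fun n => ?_⟩
        exact inv_pos.mpr (hη0.trans_le (hbη n))
      refine h1.inv_tendsto_nhdsGT_zero.congr fun n => ?_
      simp
    set c := ∫ u, K u * (Set.Iio (0 : ℝ)).indicator (fun _ => (1 : ℝ)) u with hcdef
    have hconst : ∀ x, cdf μ x = c := fun x => by
      refine tendsto_nhds_unique (hblim x) (hdct x _ ?_)
      filter_upwards [Measure.ae_ne volume (0 : ℝ)] with u hu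
      rcases lt_or_gt_of_ne hu with h1 | h1
      · have h2 : Tendsto (fun n => x - b n * u) atTop atTop := by
          have h3 := tendsto_atTop_add_const_left atTop x
            (hbtop.atTop_mul_const (neg_pos.mpr h1))
          refine h3.congr fun n => by ring
        have h4 : (Set.Iio (0 : ℝ)).indicator (fun _ => (1 : ℝ)) u = 1 := by simp [h1]
        rw [h4]
        exact (tendsto_cdf_atTop μ).comp h2
      · have h2 : Tendsto (fun n => x - b n * u) atTop atBot := by
          have h3 := tendsto_atBot_add_const_left atTop x
            (tendsto_neg_atTop_atBot.comp (hbtop.atTop_mul_const h1))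
          refine h3.congr fun n => by simp [sub_eq_add_neg]
        have h4 : (Set.Iio (0 : ℝ)).indicator (fun _ => (1 : ℝ)) u = 0 := by simp [h1.le]
        rw [h4]
        exact (tendsto_cdf_atBot μ).comp h2
    have h1 := tendsto_cdf_atTop μ
    have h2 := tendsto_cdf_atBot μ
    rw [funext hconst] at h1 h2
    have h3 := tendsto_nhds_unique h1 tendsto_const_nhds
    have h4 := tendsto_nhds_unique h2 tendsto_const_nhds
    rw [← h4] at h3
    exact one_ne_zero h3
  · have hbs : Tendsto b atTop (𝓝 s⁻¹) := by
      have h1 := hsq.inv₀ h0.ne'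
      simpa using h1
    refine not_forall_kernelSmooth_cdf_eq hK hl μ (inv_pos.mpr h0) fun x => ?_
    refine tendsto_nhds_unique (hdct x (fun u => cdf μ (x - s⁻¹ * u)) (ae_of_all _ fun u => ?_))
      (hblim x)
    exact (hc.tendsto _).comp (tendsto_const_nhds.sub (hbs.mul_const u))

end Identification

/-! ### Solving the discrepancy equation for the bandwidth. -/

section Assembly

lemma tendsto_kernelSmooth_atBot {K : ℝ → ℝ} (hK : Integrable K) {F : ℝ → ℝ} (hF : Measurable F)
    {B : ℝ} (hB : ∀ x, |F x| ≤ B) (h0 : Tendsto F atBot (𝓝 0)) (h : ℝ) :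
    Tendsto (kernelSmooth K h F) atBot (𝓝 0) := by
  have h1 : Tendsto (kernelSmooth K h F) atBot (𝓝 (∫ u, K u * 0)) := by
    refine tendsto_integral_filter_of_dominated_convergence (fun u => |K u| * B)
      (Eventually.of_forall fun x => (integrable_mul_comp hK hF hB h x).aestronglyMeasurable)
      (Eventually.of_forall fun x => ae_of_all _ fun u => ?_) (hK.abs.mul_const B)
      (ae_of_all _ fun u => ?_)
    · rw [Real.norm_eq_abs, abs_mul]
      exact mul_le_mul_of_nonneg_left (hB _) (abs_nonneg _)
    · exact (h0.comp (tendsto_atBot_add_const_right _ (-(h * u)) tendsto_id)).const_mul _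
  simpa using h1

/-- The derivative of order `l` of a distribution function is not identically zero, measured in
any of the distances. -/
lemma distance_derivative_pos (d : DistanceKind) {K : ℝ → ℝ} {l : ℕ} (hK : IsKernelOfOrder K l)
    (hl : 1 ≤ l) {μ : Measure ℝ} [IsProbabilityMeasure μ] {F : ℕ → ℝ → ℝ}
    (hF0 : F 0 = cdf μ) (hF : ∀ j < l, ∀ x, HasDerivAt (F j) (F (j + 1) x) x)
    (hc : Continuous (F l)) {B : ℝ} (hB : ∀ x, |F l x| ≤ B) (hbot : Tendsto (F l) atBot (𝓝 0)) :
    0 < d.distance (F l) 0 := by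
  by_contra hneg
  have hzero : ∀ x, F l x = 0 := fun x =>
    abs_nonpos_iff.mp ((d.abs_le_distance_zero hB hbot x).trans (not_lt.mp hneg))
  -- If `F l` vanishes, `F 0` is a polynomial of degree below `l`, and a kernel of order `l`
  -- reproduces such polynomials at any bandwidth, here one.
  refine not_forall_kernelSmooth_cdf_eq hK hl μ one_pos fun x => ?_
  rw [← hF0]
  have h1 : ∀ u, K u * F 0 (x - 1 * u) = ∑ j ∈ Finset.range l,
      (F j x * (-1) ^ j / (j.factorial : ℝ)) * (u ^ j * K u) := fun u => by
    obtain ⟨ξ, -, h2⟩ := exists_taylor_remainder hl hF hc x (-u)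
    rw [one_mul, sub_eq_add_neg, h2, hzero, zero_mul, zero_div, add_zero, Finset.mul_sum]
    refine Finset.sum_congr rfl fun j _ => ?_
    rw [neg_pow]
    ring
  simp only [kernelSmooth, h1]
  rw [integral_sum_moments hK hl]
  simp

/-- The leading term of the distance between a function and its kernel smooth. -/
lemma exists_forall_abs_distance_sub_le (d : DistanceKind) {K : ℝ → ℝ} {l : ℕ}
    (hK : IsKernelOfOrder K l) (hl : 1 ≤ l) {F : ℕ → ℝ → ℝ}
    (hF : ∀ j < l, ∀ x, HasDerivAt (F j) (F (j + 1) x) x) (hc : UniformContinuous (F l))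
    {B₀ B : ℝ} (hB₀ : ∀ x, |F 0 x| ≤ B₀) (hB : ∀ x, |F l x| ≤ B) {η : ℝ} (hη : 0 < η) :
    ∃ h₀ : ℝ, 0 < h₀ ∧ ∀ h : ℝ, 0 < h → h < h₀ →
      |d.distance (fun t => F 0 t - kernelSmooth K h (F 0) t) 0 -
        h ^ l * (|kernelMoment K l| * d.distance (F l) 0 / (l.factorial : ℝ))| ≤ η * h ^ l := by
  have hd := d.const_pos
  obtain ⟨h₀, hh₀, hbias⟩ := exists_forall_abs_kernelSmooth_sub_le hK hl hF hc hB₀ hB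
    (η := η / d.const) (by positivity)
  refine ⟨h₀, hh₀, fun h hh hhlt => ?_⟩
  set a := -((-h) ^ l * kernelMoment K l / (l.factorial : ℝ)) with ha
  have h1 : ∀ t, |F 0 t - kernelSmooth K h (F 0) t - a * F l t| ≤ η / d.const * h ^ l := fun t => by
    rw [← abs_neg]
    refine le_trans (le_of_eq ?_) (hbias h hh hhlt t)
    congr 1
    rw [ha]
    ring
  have h2 := d.abs_distance_sub_le (ψ := fun t => a * F l t) (B := B₀ + kernelL1Norm K * B₀)
    (fun t => (abs_sub _ _).trans
      (add_le_add (hB₀ t) (abs_kernelSmooth_le hK.integrable hB₀ h t))) h1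
  rw [d.distance_const_mul] at h2
  have h3 : |a| * d.distance (F l) 0 =
      h ^ l * (|kernelMoment K l| * d.distance (F l) 0 / (l.factorial : ℝ)) := by
    rw [ha, abs_neg, abs_div, abs_mul, abs_pow, abs_neg, abs_of_pos hh, Nat.abs_cast]
    ring
  rw [h3] at h2
  refine h2.trans (le_of_eq ?_)
  field_simp

/-- Conversion of asymptotic bounds on `h ^ l / r` into bounds on the normalised bandwidth. -/
lemma le_liminf_and_limsup_le {l : ℕ} (hl : l ≠ 0) {h ρ : ℕ → ℝ}
    (hpos : ∀ᶠ n in atTop, 0 < h n) (hρ : ∀ᶠ n in atTop, 0 < ρ n) {s t : ℝ} (hs : 0 ≤ s)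
    (ht : 0 ≤ t)
    (hlow : ∀ a : ℝ, 0 ≤ a → a < s → ∀ᶠ n in atTop, a * ρ n ^ (1 / 2 : ℝ) ≤ h n ^ l)
    (hup : ∀ b : ℝ, t < b → ∀ᶠ n in atTop, h n ^ l ≤ b * ρ n ^ (1 / 2 : ℝ)) :
    ((s ^ (1 / (l : ℝ)) : ℝ) : EReal) ≤
        liminf (fun n => ((h n / ρ n ^ (1 / (2 * (l : ℝ))) : ℝ) : EReal)) atTop ∧
      limsup (fun n => ((h n / ρ n ^ (1 / (2 * (l : ℝ))) : ℝ) : EReal)) atTop ≤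
        ((t ^ (1 / (l : ℝ)) : ℝ) : EReal) := by
  have hl' : (l : ℝ) ≠ 0 := by exact_mod_cast hl
  have hroot : ∀ x : ℝ, 0 ≤ x → (x ^ (1 / (l : ℝ))) ^ l = x := fun x hx => by
    rw [one_div]
    exact Real.rpow_inv_natCast_pow hx hl
  have hpow : ∀ n, 0 < ρ n →
      (h n / ρ n ^ (1 / (2 * (l : ℝ)))) ^ l * ρ n ^ (1 / 2 : ℝ) = h n ^ l := fun n hn => by
    have h1 : (ρ n ^ (1 / (2 * (l : ℝ)))) ^ l = ρ n ^ (1 / 2 : ℝ) := by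
      rw [← Real.rpow_natCast, ← Real.rpow_mul hn.le]
      congr 1
      field_simp
    rw [div_pow, h1, div_mul_cancel₀]
    positivity
  constructor
  · refine le_of_forall_lt fun c hc => ?_
    obtain ⟨z', hcz', hz's⟩ := EReal.lt_iff_exists_real_btwn.mp hc
    refine hcz'.trans_le ?_
    have hz's' : z' < s ^ (1 / (l : ℝ)) := by exact_mod_cast hz's
    refine le_liminf_of_le (by isBoundedDefault) ?_
    rcases lt_or_ge z' 0 with hneg | hnn
    · filter_upwards [hpos, hρ] with n h1 h2
      have : 0 ≤ h n / ρ n ^ (1 / (2 * (l : ℝ))) := by positivity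
      exact_mod_cast hneg.le.trans this
    · have h3 : z' ^ l < s := by
        rw [← hroot s hs]
        exact pow_lt_pow_left₀ hz's' hnn hl
      filter_upwards [hpos, hρ, hlow _ (by positivity) h3] with n h1 h2 h4
      rw [← hpow n h2] at h4
      have h5 := le_of_mul_le_mul_right h4 (by positivity)
      have h6 := (pow_le_pow_iff_left₀ hnn (by positivity) hl).mp h5
      exact_mod_cast h6
  · refine le_of_forall_gt fun c hc => ?_
    obtain ⟨z', hz't, hcz'⟩ := EReal.lt_iff_exists_real_btwn.mp hc
    refine lt_of_le_of_lt ?_ hcz'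
    have hz't' : t ^ (1 / (l : ℝ)) < z' := by exact_mod_cast hz't
    have hz0 : 0 ≤ t ^ (1 / (l : ℝ)) := by positivity
    refine limsup_le_of_le (by isBoundedDefault) ?_
    have h3 : t < z' ^ l := by
      conv_lhs => rw [← hroot t ht]
      exact pow_lt_pow_left₀ hz't' hz0 hl
    filter_upwards [hpos, hρ, hup _ h3] with n h1 h2 h4
    rw [← hpow n h2] at h4
    have h5 := le_of_mul_le_mul_right h4 (by positivity)
    have h6 := (pow_le_pow_iff_left₀ (by positivity) (hz0.trans hz't'.le) hl).mp h5
    exact_mod_cast h6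

lemma tendsto_lilRate : Tendsto lilRate atTop (𝓝 0) := by
  have h1 : Tendsto (fun n : ℕ => Real.log n / n) atTop (𝓝 0) := by
    have h2 := (Real.tendsto_pow_log_div_mul_add_atTop 1 0 1 one_ne_zero).comp
      tendsto_natCast_atTop_atTop
    simpa [Function.comp_def] using h2
  have hlog : Tendsto (fun n : ℕ => Real.log n) atTop atTop :=
    Real.tendsto_log_atTop.comp tendsto_natCast_atTop_atTop
  refine tendsto_of_tendsto_of_tendsto_of_le_of_le' tendsto_const_nhds h1 ?_ ?_
  · filter_upwards [hlog.eventually_ge_atTop 1] with n hn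
    have : 0 ≤ Real.log (Real.log n) := Real.log_nonneg hn
    exact div_nonneg this (by positivity)
  · filter_upwards [hlog.eventually_ge_atTop 1, eventually_gt_atTop 0] with n hn hn0
    have hn' : (0 : ℝ) < n := by exact_mod_cast hn0
    have h3 := Real.log_le_sub_one_of_pos (by linarith : 0 < Real.log n)
    have h4 : 0 ≤ Real.log (Real.log n) := Real.log_nonneg hn
    rw [lilRate, div_le_div_iff₀ (by positivity) hn']
    nlinarith

lemma eventually_lilRate_pos : ∀ᶠ n in atTop, 0 < lilRate n := by
  have hlog : Tendsto (fun n : ℕ => Real.log n) atTop atTop :=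
    Real.tendsto_log_atTop.comp tendsto_natCast_atTop_atTop
  filter_upwards [hlog.eventually_gt_atTop 1, eventually_gt_atTop 0] with n hn hn0
  have hn' : (0 : ℝ) < n := by exact_mod_cast hn0
  exact div_pos (Real.log_pos hn) (by positivity)

/-- The deterministic part: bandwidths chosen by the discrepancy principle along a sample whose
empirical distribution functions obey the law of the iterated logarithm. -/
theorem discrepancy_bandwidth_bounds (d : DistanceKind) {K : ℝ → ℝ} {l : ℕ}
    (hK : IsKernelOfOrder K l) (hl : 1 ≤ l) {μ : Measure ℝ} [IsProbabilityMeasure μ]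
    {F : ℕ → ℝ → ℝ} (hF0 : F 0 = cdf μ) (hF : ∀ j < l, ∀ x, HasDerivAt (F j) (F (j + 1) x) x)
    (hcont : Continuous (F l)) (hbot : Tendsto (F l) atBot (𝓝 0))
    (htop : Tendsto (F l) atTop (𝓝 0)) {ε : ℝ} (hε : 0 < ε) {x : ℕ → ℝ}
    (hx : ∀ δ : ℝ, 0 < δ → ∀ᶠ n : ℕ in atTop, ∀ t,
      |empiricalDF n x t - cdf μ t| ≤ (1 + δ) * lilRate n ^ (1 / 2 : ℝ))
    {h : ℕ → ℝ} (hh : ∀ᶠ n in atTop, IsDiscrepancyBandwidth d K n x (threshold d K ε n) (h n)) :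
    (((d.const * ε * (Nat.factorial l : ℝ) / (|kernelMoment K l| * d.distance (F l) 0)) ^
        (1 / (l : ℝ)) : ℝ) : EReal) ≤
      liminf (fun n : ℕ => ((h n / lilRate n ^ (1 / (2 * (l : ℝ))) : ℝ) : EReal)) atTop ∧
    limsup (fun n : ℕ => ((h n / lilRate n ^ (1 / (2 * (l : ℝ))) : ℝ) : EReal)) atTop ≤
      (((d.const * (2 * kernelL1Norm K + 2 + ε) * (Nat.factorial l : ℝ) /
        (|kernelMoment K l| * d.distance (F l) 0)) ^ (1 / (l : ℝ)) : ℝ) : EReal) := by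
  have hd := d.const_pos
  have hk0 : 0 ≤ kernelL1Norm K := integral_nonneg fun u => abs_nonneg _
  have hcocompact : Tendsto (F l) (cocompact ℝ) (𝓝 0) := by
    rw [cocompact_eq_atBot_atTop]
    exact hbot.sup htop
  have huc : UniformContinuous (F l) := hcont.uniformContinuous_of_tendsto_cocompact hcocompact
  obtain ⟨B, hB⟩ : ∃ B, ∀ y, |F l y| ≤ B := by
    obtain ⟨B, hB⟩ := (ZeroAtInftyContinuousMap.isBounded_range
      (⟨⟨F l, hcont⟩, hcocompact⟩ : ZeroAtInftyContinuousMap ℝ ℝ)).exists_norm_le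
    exact ⟨B, fun y => hB _ ⟨y, rfl⟩⟩
  have hFc : Continuous (F 0) :=
    continuous_iff_continuousAt.mpr fun z => (hF 0 (by omega) z).continuousAt
  have hF1 : ∀ y, |F 0 y| ≤ 1 := fun y => by
    rw [hF0, abs_of_nonneg (cdf_nonneg μ y)]
    exact cdf_le_one μ y
  have hF0bot : Tendsto (F 0) atBot (𝓝 0) := by
    rw [hF0]
    exact tendsto_cdf_atBot μ
  have hNpos := distance_derivative_pos d hK hl hF0 hF hcont hB hbot
  set A := |kernelMoment K l| * d.distance (F l) 0 / (l.factorial : ℝ) with hA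
  have hkpos : 0 < |kernelMoment K l| := abs_pos.mpr hK.moment_ne_zero
  have hfac : (0 : ℝ) < l.factorial := by exact_mod_cast l.factorial_pos
  have hApos : 0 < A := by positivity
  set r : ℕ → ℝ := fun n => lilRate n ^ (1 / 2 : ℝ) with hr
  have hrpos : ∀ᶠ n in atTop, 0 < r n := by
    filter_upwards [eventually_lilRate_pos] with n hn
    exact Real.rpow_pos_of_pos hn _
  have hr0 : Tendsto r atTop (𝓝 0) := by
    have := tendsto_lilRate.rpow_const (p := (1 / 2 : ℝ)) (Or.inr (by norm_num))
    rwa [Real.zero_rpow (by norm_num)] at this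
  set D : ℕ → ℝ := fun n => d.distance (fun t => F 0 t - kernelSmooth K (h n) (F 0) t) 0 with hD
  have hpos : ∀ᶠ n in atTop, 0 < h n := hh.mono fun n hn => hn.1
  have hDbound : ∀ τ : ℝ, 0 < τ → ∀ᶠ n in atTop,
      (d.const * ε - τ) * r n ≤ D n ∧ D n ≤ (d.const * (2 * kernelL1Norm K + 2 + ε) + τ) * r n :=
    fun τ hτ => by
      -- This parameter makes the stochastic error exactly `(c_d (1 + k̃) + τ) r n`; subtracted from
      -- and added to the threshold it leaves `c_d ε - τ` and `c_d (2 k̃ + 2 + ε) + τ`.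
      filter_upwards [hh, hx (τ / (d.const * (1 + kernelL1Norm K))) (by positivity)] with n h1 h2
      rw [← hF0] at h2
      have h3 := abs_distance_estimator_sub_le d hK.integrable h1.1 x hFc.measurable hF1 h2
      rw [h1.2, threshold] at h3
      have h4 : d.const * ((1 + kernelL1Norm K) *
          ((1 + τ / (d.const * (1 + kernelL1Norm K))) * lilRate n ^ (1 / 2 : ℝ))) =
          (d.const * (1 + kernelL1Norm K) + τ) * r n := by
        simp only [hr]
        field_simp
      rw [h4] at h3
      obtain ⟨h5, h6⟩ := abs_le.mp h3
      simp only [hD, hr] at h5 h6 ⊢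
      constructor <;> linarith
  have hDlim : Tendsto D atTop (𝓝 0) := by
    have h1 := hr0.const_mul (d.const * (2 * kernelL1Norm K + 2 + ε) + 1)
    rw [mul_zero] at h1
    refine tendsto_of_tendsto_of_tendsto_of_le_of_le' tendsto_const_nhds h1
      (Eventually.of_forall fun n => d.distance_zero_nonneg _) ?_
    exact (hDbound 1 one_pos).mono fun n hn => hn.2
  have hhlim : Tendsto h atTop (𝓝 0) := by
    refine tendsto_bandwidth_zero hK hl (hF0 ▸ hFc) hpos fun y => ?_
    rw [← hF0]
    have h1 : ∀ n, |F 0 y - kernelSmooth K (h n) (F 0) y| ≤ D n := fun n => by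
      refine d.abs_le_distance_zero (φ := fun t => F 0 t - kernelSmooth K (h n) (F 0) t)
        (B := 1 + kernelL1Norm K * 1) (fun t => (abs_sub _ _).trans
          (add_le_add (hF1 t) (abs_kernelSmooth_le hK.integrable hF1 (h n) t))) ?_ y
      simpa using hF0bot.sub
        (tendsto_kernelSmooth_atBot hK.integrable hFc.measurable hF1 hF0bot (h n))
    rw [tendsto_iff_dist_tendsto_zero]
    refine squeeze_zero (fun n => dist_nonneg) (fun n => ?_) hDlim
    rw [dist_comm, Real.dist_eq]
    exact h1 n
  have hbias : ∀ τ : ℝ, 0 < τ → ∀ᶠ n in atTop, |D n - h n ^ l * A| ≤ τ * h n ^ l := fun τ hτ => by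
    obtain ⟨h₀, hh₀, hb⟩ := exists_forall_abs_distance_sub_le d hK hl hF huc hF1 hB hτ
    filter_upwards [hpos, hhlim.eventually (gt_mem_nhds hh₀)] with n h1 h2
    exact hb (h n) h1 h2
  have hdiv : ∀ c : ℝ, c * (l.factorial : ℝ) / (|kernelMoment K l| * d.distance (F l) 0) = c / A :=
    fun c => by
      rw [hA]
      field_simp
  rw [hdiv, hdiv]
  have hC : 0 < d.const * (2 * kernelL1Norm K + 2 + ε) := by positivity
  refine le_liminf_and_limsup_le (by omega) hpos eventually_lilRate_pos (by positivity)
    (by positivity) (fun a ha0 ha => ?_) fun b hb => ?_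
  · rw [lt_div_iff₀ hApos] at ha
    -- This `τ` solves `c_d ε - τ = a (A + τ)`, so the lower bound on `D n` and the bias bound meet
    -- exactly.
    have hτ : 0 < (d.const * ε - a * A) / (a + 1) := div_pos (by linarith) (by linarith)
    filter_upwards [hDbound _ hτ, hbias _ hτ, hrpos] with n h1 h2 h3
    set τ := (d.const * ε - a * A) / (a + 1) with hτdef
    have h4 : τ * (a + 1) = d.const * ε - a * A := div_mul_cancel₀ _ (by linarith)
    have h5 := (abs_le.mp h2).2
    have h6 : a * r n * (A + τ) ≤ h n ^ l * (A + τ) := by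
      have h7 : (d.const * ε - τ) * r n = a * r n * (A + τ) := by
        linear_combination (-r n) * h4
      linarith [h1.1]
    exact le_of_mul_le_mul_right h6 (by linarith)
  · have hb0 : 0 < b := lt_trans (by positivity) hb
    rw [div_lt_iff₀ hApos] at hb
    set C := d.const * (2 * kernelL1Norm K + 2 + ε) with hCdef
    -- Likewise `τ` solves `C + τ = b (A - τ)`, which also shows `A - τ > 0`.
    have hτ : 0 < (b * A - C) / (b + 1) := div_pos (by linarith) (by linarith)
    filter_upwards [hDbound _ hτ, hbias _ hτ, hrpos] with n h1 h2 h3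
    set τ := (b * A - C) / (b + 1) with hτdef
    have h4 : τ * (b + 1) = b * A - C := div_mul_cancel₀ _ (by linarith)
    have h5 := (abs_le.mp h2).1
    have h6 : h n ^ l * (A - τ) ≤ b * r n * (A - τ) := by
      have h7 : (C + τ) * r n = b * r n * (A - τ) := by
        linear_combination (r n) * h4
      linarith [h1.2]
    have h8 : 0 < A - τ := by
      have h9 : 0 < b * (A - τ) := by
        have : b * (A - τ) = C + τ := by linear_combination -h4
        rw [this]
        linarith
      exact pos_of_mul_pos_right h9 hb0.le
    exact le_of_mul_le_mul_right h6 h8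

end Assembly

/-! ### The distribution function of the density and the final theorem. -/

lemma cdf_withDensity_ofReal {f : ℝ → ℝ} (hf : Integrable f) (hf0 : 0 ≤ᵐ[volume] f)
    [IsProbabilityMeasure (volume.withDensity fun x => ENNReal.ofReal (f x))] (x : ℝ) :
    cdf (volume.withDensity fun x => ENNReal.ofReal (f x)) x = ∫ y in Set.Iic x, f y := by
  rw [cdf_eq_real, measureReal_def, withDensity_apply _ measurableSet_Iic,
    ← ofReal_integral_eq_lintegral_ofReal hf.integrableOn (ae_restrict_of_ae hf0),
    ENNReal.toReal_ofReal]
  exact integral_nonneg_of_ae (ae_restrict_of_ae hf0)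

end DiscrepancyPrinciple

theorem mainTheorem7 {Ω : Type*} [MeasurableSpace Ω] (P : Measure Ω) [IsProbabilityMeasure P]
    (X : ℕ → Ω → ℝ) (hX_meas : ∀ i, Measurable (X i)) (hX_indep : iIndepFun X P)
    (f : ℝ → ℝ) (hf_nonneg : 0 ≤ᵐ[volume] f)
    (hX_law : ∀ i, P.map (X i) = volume.withDensity (fun x => ENNReal.ofReal (f x)))
    (l : ℕ) (hl : 2 ≤ l) (hf : DiscrepancyPrinciple.MemSobolevL1 l f)
    (K : ℝ → ℝ) (hK : DiscrepancyPrinciple.IsKernelOfOrder K l)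
    (d : DiscrepancyPrinciple.DistanceKind) (ε : ℝ) (hε : 0 < ε) :
    ∀ᵐ ω ∂P, ∀ h : ℕ → ℝ,
      (∀ᶠ n in atTop, DiscrepancyPrinciple.IsDiscrepancyBandwidth d K n (fun i => X i ω)
        (DiscrepancyPrinciple.threshold d K ε n) (h n)) →
      (((d.const * ε * (Nat.factorial l : ℝ) /
          (|DiscrepancyPrinciple.kernelMoment K l| *
            d.distance (DiscrepancyPrinciple.continuousWeakDeriv (l - 1) f) 0)) ^
              (1 / (l : ℝ)) : ℝ) : EReal) ≤
        liminf (fun n : ℕ =>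
          ((h n / DiscrepancyPrinciple.lilRate n ^ (1 / (2 * (l : ℝ))) : ℝ) : EReal)) atTop ∧
      limsup (fun n : ℕ =>
          ((h n / DiscrepancyPrinciple.lilRate n ^ (1 / (2 * (l : ℝ))) : ℝ) : EReal)) atTop ≤
        (((d.const * (2 * DiscrepancyPrinciple.kernelL1Norm K + 2 + ε) * (Nat.factorial l : ℝ) /
          (|DiscrepancyPrinciple.kernelMoment K l| *
            d.distance (DiscrepancyPrinciple.continuousWeakDeriv (l - 1) f) 0)) ^
              (1 / (l : ℝ)) : ℝ) : EReal) := by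
  obtain ⟨F, hF0, hF, hcont, hbot, htop, hweak⟩ := hf.exists_derivatives (by omega)
  have : IsProbabilityMeasure (volume.withDensity fun x => ENNReal.ofReal (f x)) := by
    rw [← hX_law 0]
    exact Measure.isProbabilityMeasure_map (hX_meas 0).aemeasurable
  have hF0' : F 0 = cdf (volume.withDensity fun x => ENNReal.ofReal (f x)) := by
    ext x
    rw [hF0, DiscrepancyPrinciple.cdf_withDensity_ofReal hf.1 hf_nonneg]
  have hcdf : Continuous (cdf (volume.withDensity fun x => ENNReal.ofReal (f x))) := by
    rw [← hF0']
    exact continuous_iff_continuousAt.mpr fun z => (hF 0 (by omega) z).continuousAt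
  filter_upwards [DiscrepancyPrinciple.ae_eventually_abs_empiricalDF_sub_cdf_le hX_meas hX_indep
    hX_law hcdf] with ω hω h hh
  rw [hweak]
  exact DiscrepancyPrinciple.discrepancy_bandwidth_bounds d hK (by omega) hF0' hF hcont hbot htop
    hε hω hh
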